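/- Let $L>0$, let $a,b,c>0$ be constants and let $p\in L^1[0,L]$. Here $W^{4,1}[0,L]$ is the space of functions $y\in C^3[0,L]$ with $y'''$ absolutely continuous, and equations and inequalities involving $p$ or fourth derivatives are understood for almost every $x\in(0,L)$. Consider the Melan problem $$w''''(x)-\Bigl(a+b\int_0^L w\Bigr)w''(x)+c\int_0^L w=p(x),\quad x\in(0,L),\qquad w(0)=w(L)=w''(0)=w''(L)=0, \tag{1}$$ whose solutions are sought in $W^{4,1}[0,L]$. A lower solution (upper solution) of (1) is a function in $W^{4,1}[0,L]$ that satisfies the boundary conditions and the differential equation with "$=$" replaced by "$\le$" ("$\ge$"). Let $M,N>0$ be constants with $$N\le\frac{4M}{L^3}\,\sigma(\sqrt M L),\qquad \sigma(k):=\frac{3k^3}{6k\cosh k+6k-12\sinh k-k^3}.$$ Let $\alpha$ be a lower solution and $\beta$ an upper solution of (1) with $$0\le\alpha(x)\le\beta(x),\qquad 0\ge\alpha''(x)\ge\beta''(x)\qquad(x\in[0,L]),$$ $$a+b\int_0^L\beta\le M,\qquad c-b\min_{x\in[0,L]}\beta''(x)\le N,$$ and assume moreover that $$a+b\int_0^L\alpha+\frac{L^3}{4}c>\frac{L^3N}{4}+M-\frac{4}{L^2}.$$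 Put $[\alpha,\beta]:=\{u\in C^2[0,L]:\ \alpha\le u\le\beta,\ \alpha''\ge u''\ge\beta''\text{ on }[0,L]\}$. For $y_0\in[\alpha,\beta]$ consider the iteration, for $n=1,2,\dots$, with $y_n\in W^{4,1}[0,L]$, $$y_n''''-My_n''+N\int_0^L y_n=p+ay_{n-1}''+b\,y_{n-1}''\int_0^L y_{n-1}-c\int_0^L y_{n-1}-My_{n-1}''+N\int_0^L y_{n-1}, \tag{2}$$ $$y_n(0)=y_n(L)=y_n''(0)=y_n''(L)=0.$$ Then for every $y_0\in[\alpha,\beta]$ the iteration (2) determines a unique sequence $(y_n)$. The sequences $(\alpha_n)$ and $(\beta_n)$ obtained from $y_0=\alpha$ and $y_0=\beta$ are monotone: for all $n\ge 0$, on $[0,L]$, $$\alpha_n\le\alpha_{n+1},\quad \alpha_n\le\beta_n,\quad \beta_{n+1}\le\beta_n,\qquad \alpha_n''\ge\alpha_{n+1}'',\quad \alpha_n''\ge\beta_n'',\quad \beta_{n+1}''\ge\beta_n''.$$ Problem (1) has exactly one solution $\tilde y$ in $[\alpha,\beta]$; both $(\alpha_n)$ and $(\beta_n)$ converge uniformly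 on $[0,L]$ to $\tilde y$, and for every $y_0\in[\alpha,\beta]$ the sequence $(y_n)$ converges uniformly on $[0,L]$ to $\tilde y$. -/

import Mathlib

open Set MeasureTheory Filter Topology

noncomputable section

namespace Melan

/-- The `k`-th derivative on `[0, L]` (one-sided at the endpoints) of a function regarded as a
function on `[0, L]`; it depends only on the values of the function on `[0, L]`. -/
def D (L : ℝ) (k : ℕ) (y : ℝ → ℝ) : ℝ → ℝ :=
  iteratedDerivWithin k y (Icc 0 L)

/-- The Sobolev space `W^{4,1}[0, L]` (continuous representatives): the functions of class `C³`
on `[0, L]` whose third derivative is absolutely continuous. The fourth derivative `D L 4 y` then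
exists almost everywhere and is integrable. -/
def MemW41 (L : ℝ) (y : ℝ → ℝ) : Prop :=
  ContDiffOn ℝ 3 y (Icc 0 L) ∧ AbsolutelyContinuousOnInterval (D L 3 y) 0 L

/-- The Navier boundary conditions `y(0) = y(L) = y''(0) = y''(L) = 0`. -/
def NavierBC (L : ℝ) (y : ℝ → ℝ) : Prop :=
  y 0 = 0 ∧ y L = 0 ∧ D L 2 y 0 = 0 ∧ D L 2 y L = 0

/-- The left-hand side `y'''' - (a + b ∫ y) y'' + c ∫ y` of the Melan equation. -/
def melanOp (L a b c : ℝ) (y : ℝ → ℝ) (x : ℝ) : ℝ :=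
  D L 4 y x - (a + b * ∫ t in (0 : ℝ)..L, y t) * D L 2 y x + c * ∫ t in (0 : ℝ)..L, y t

/-- Solutions in `W^{4,1}[0, L]` of the Melan boundary value problem. -/
def IsSolution (L a b c : ℝ) (p y : ℝ → ℝ) : Prop :=
  MemW41 L y ∧ NavierBC L y ∧ ∀ᵐ x, x ∈ Ioo 0 L → melanOp L a b c y x = p x

def IsLowerSolution (L a b c : ℝ) (p α : ℝ → ℝ) : Prop :=
  MemW41 L α ∧ NavierBC L α ∧ ∀ᵐ x, x ∈ Ioo 0 L → melanOp L a b c α x ≤ p x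

def IsUpperSolution (L a b c : ℝ) (p β : ℝ → ℝ) : Prop :=
  MemW41 L β ∧ NavierBC L β ∧ ∀ᵐ x, x ∈ Ioo 0 L → p x ≤ melanOp L a b c β x

def sigma (k : ℝ) : ℝ :=
  3 * k ^ 3 / (6 * k * Real.cosh k + 6 * k - 12 * Real.sinh k - k ^ 3)

/-- The set `[α, β]` of all `u ∈ C²[0, L]` with `α ≤ u ≤ β` and `α'' ≥ u'' ≥ β''` on `[0, L]`. -/
def orderInterval (L : ℝ) (α β : ℝ → ℝ) : Set (ℝ → ℝ) :=
  {u | ContDiffOn ℝ 2 u (Icc 0 L) ∧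
    ∀ x ∈ Icc 0 L, (α x ≤ u x ∧ u x ≤ β x) ∧ (D L 2 β x ≤ D L 2 u x ∧ D L 2 u x ≤ D L 2 α x)}

/-- The linear operator `G y = y'''' - M y'' + N ∫ y`. -/
def linOp (L M N : ℝ) (y : ℝ → ℝ) (x : ℝ) : ℝ :=
  D L 4 y x - M * D L 2 y x + N * ∫ t in (0 : ℝ)..L, y t

/-- The nonlinearity `f(x, ∫ y, y'') = p + a y'' + b y'' ∫ y - c ∫ y`. -/
def nonlin (L a b c : ℝ) (p y : ℝ → ℝ) (x : ℝ) : ℝ :=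
  p x + a * D L 2 y x + b * D L 2 y x * (∫ t in (0 : ℝ)..L, y t) - c * ∫ t in (0 : ℝ)..L, y t

/-- `z` is obtained from `y` by one step of the iterative procedure:
`G z = f(x, ∫ y, y'') - M y'' + N ∫ y`, with `z` in the domain of `G`. -/
def IsStep (L a b c M N : ℝ) (p y z : ℝ → ℝ) : Prop :=
  MemW41 L z ∧ NavierBC L z ∧ ∀ᵐ x, x ∈ Ioo 0 L →
    linOp L M N z x =
      nonlin L a b c p y x - M * D L 2 y x + N * ∫ t in (0 : ℝ)..L, y t

/-- `y` is a sequence produced by the iterative procedure with the initial function `y₀`. -/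
def IsIteration (L a b c M N : ℝ) (p y₀ : ℝ → ℝ) (y : ℕ → ℝ → ℝ) : Prop :=
  y 0 = y₀ ∧ ∀ n, IsStep L a b c M N p (y n) (y (n + 1))

end Melan

end

namespace Melan

/-! ### Absolutely continuous functions and convexity -/

/-! Everything rests on a maximum principle for `G y = y'''' - M y'' + N ∫ y`: under the Navier
conditions, `G y ≥ 0` forces `y'' ≤ 0`, hence `y ≥ 0` (`deriv2_nonpos_of_linOp_nonneg`,
`comparison`). Put `u = -y''`, `M = k²` and `h = G y`. Then `-u'' + k² u = h - N I` with `I = ∫ y =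
∫ s (L - s) / 2 * u`, a Dirichlet problem perturbed by a rank-one term. Testing with a suitable
function expresses `I` through `h`, so `u(x)` becomes an integral of `h` against an explicit kernel.
The bound on `N` through `sigma` makes this kernel nonnegative.

Uniqueness for `G` follows, and with it solvability, since only a scalar equation for the nonlocal
term remains. Order functions by `u ≼ v` iff `u ≤ v` and `v'' ≤ u''`. The bounds involving `β` make
the right-hand side of the iteration increasing on `[α, β]`, so the step preserves order and maps
`[α, β]` into itself (`step_mono`, `step_mem`).

The last hypothesis makes the step halve any bound on `u'' - v''` for `u ≼ v` (`step_contr`). The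
iterations from `α` and `β` therefore close up geometrically and squeeze every other iteration
between them. A solution is a constant iteration, which gives uniqueness and convergence; existence
comes from the common limit of the two extremal iterations. -/

theorem absolutelyContinuous_of_hasDerivWithinAt {f f' : ℝ → ℝ} {s t : ℝ} (hst : s ≤ t)
    (hf : ∀ x ∈ Icc s t, HasDerivWithinAt f (f' x) (Icc s t) x)
    (hf' : ContinuousOn f' (Icc s t)) : AbsolutelyContinuousOnInterval f s t := by
  obtain ⟨K, hK⟩ := isCompact_Icc.exists_bound_of_continuousOn hf'
  have hK' : ∀ x ∈ Icc s t, ‖f' x‖₊ ≤ K.toNNReal := fun x hx => by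
    rw [← NNReal.coe_le_coe, coe_nnnorm]
    exact (hK x hx).trans (Real.le_coe_toNNReal K)
  have := (convex_Icc s t).lipschitzOnWith_of_nnnorm_hasDerivWithin_le hf hK'
  rw [← uIcc_of_le hst] at this
  exact this.absolutelyContinuousOnInterval

theorem monotoneOn_of_ae_deriv_nonneg {f : ℝ → ℝ} {L : ℝ} (hL : 0 < L)
    (hf : AbsolutelyContinuousOnInterval f 0 L)
    (h : ∀ᵐ x, x ∈ Ioo 0 L → 0 ≤ deriv f x) : MonotoneOn f (Icc 0 L) := by
  intro s hs t ht hst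
  have hsub : uIcc s t ⊆ uIcc 0 L := by
    rw [uIcc_of_le hst, uIcc_of_le hL.le]
    exact Icc_subset_Icc hs.1 ht.2
  have h1 := (hf.mono hsub).integral_deriv_eq_sub
  have h2 : 0 ≤ ∫ x in s..t, deriv f x := by
    refine intervalIntegral.integral_nonneg_of_ae_restrict hst ?_
    rw [EventuallyLE, ae_restrict_iff' measurableSet_Icc]
    have e0 : ∀ᵐ x : ℝ, x ≠ 0 := by simp [ae_iff]
    have eL : ∀ᵐ x : ℝ, x ≠ L := by simp [ae_iff]
    filter_upwards [h, e0, eL] with x hx h0 hL hxs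
    exact hx ⟨lt_of_le_of_ne (hs.1.trans hxs.1) (Ne.symm h0), lt_of_le_of_ne (hxs.2.trans ht.2) hL⟩
  linarith

/-- A monotone derivative makes `f` convex, and a convex function lies below the maximum of its end
values. -/
theorem nonpos_of_monotoneOn_deriv {f f' : ℝ → ℝ} {L : ℝ}
    (hf : ∀ x ∈ Icc 0 L, HasDerivWithinAt f (f' x) (Icc 0 L) x)
    (hf' : MonotoneOn f' (Icc 0 L)) (h0 : f 0 ≤ 0) (h1 : f L ≤ 0) :
    ∀ x ∈ Icc 0 L, f x ≤ 0 := by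
  intro x hx
  have hL : 0 ≤ L := hx.1.trans hx.2
  have hder : ∀ y ∈ interior (Icc 0 L), HasDerivAt f (f' y) y := fun y hy =>
    (hf y (interior_subset hy)).hasDerivAt (mem_interior_iff_mem_nhds.mp hy)
  have hconv : ConvexOn ℝ (Icc 0 L) f := by
    refine MonotoneOn.convexOn_of_deriv (convex_Icc 0 L)
      (fun y hy => (hf y hy).continuousWithinAt)
      (fun y hy => (hder y hy).differentiableAt.differentiableWithinAt) ?_
    intro y hy z hz hyz
    rw [(hder y hy).deriv, (hder z hz).deriv]
    exact hf' (interior_subset hy) (interior_subset hz) hyz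
  have := hconv.le_max_of_mem_Icc (left_mem_Icc.2 hL) (right_mem_Icc.2 hL) hx
  exact this.trans (max_le h0 h1)

theorem hasDerivAt_parabola (L R x : ℝ) :
    HasDerivAt (fun x => R * (x * (L - x) / 2)) (R * (L / 2 - x)) x := by
  have := ((((hasDerivAt_id x).mul ((hasDerivAt_id x).const_sub L))).div_const 2).const_mul R
  exact this.congr_deriv (by simp only [id]; ring)

/-- Subtracting the parabola `R x (L - x) / 2`, whose second derivative is `-R`, leaves a convex
function with zero end values. The constant `R L² / 8` is the maximum of the parabola. -/
theorem le_of_monotoneOn_deriv_add {f f' : ℝ → ℝ} {L R : ℝ}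
    (hf : ∀ x ∈ Icc 0 L, HasDerivWithinAt f (f' x) (Icc 0 L) x) (hR : 0 ≤ R)
    (hf' : MonotoneOn (fun x => f' x + R * x) (Icc 0 L)) (h0 : f 0 = 0) (h1 : f L = 0) :
    ∀ x ∈ Icc 0 L, f x ≤ R * (L ^ 2 / 8) := by
  intro x hx
  have := nonpos_of_monotoneOn_deriv (f := fun x => f x - R * (x * (L - x) / 2))
    (f' := fun x => f' x - R * (L / 2 - x))
    (fun y hy => (hf y hy).sub (hasDerivAt_parabola L R y).hasDerivWithinAt)
    (fun y hy z hz hyz => by have := hf' hy hz hyz; linarith)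
    (by simp [h0]) (by simp [h1]) x hx
  nlinarith [mul_nonneg hR (sq_nonneg (x - L / 2))]

theorem monotoneOn_of_hasDerivWithinAt_nonneg {f f' : ℝ → ℝ} {L : ℝ}
    (hf : ∀ x ∈ Icc 0 L, HasDerivWithinAt f (f' x) (Icc 0 L) x)
    (hf' : ∀ x ∈ Icc 0 L, 0 ≤ f' x) : MonotoneOn f (Icc 0 L) := by
  refine monotoneOn_of_deriv_nonneg (convex_Icc 0 L) (fun y hy => (hf y hy).continuousWithinAt)
    (fun y hy => ?_) (fun y hy => ?_)
  · exact ((hf y (interior_subset hy)).mono interior_subset).differentiableWithinAt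
  · rw [((hf y (interior_subset hy)).hasDerivAt (mem_interior_iff_mem_nhds.mp hy)).deriv]
    exact hf' y (interior_subset hy)

/-- A function vanishing at both ends with nonpositive second derivative is nonnegative. -/
theorem nonneg_of_deriv2_nonpos {d d₁ d₂ : ℝ → ℝ} {L : ℝ}
    (h₁ : ∀ x ∈ Icc 0 L, HasDerivWithinAt d (d₁ x) (Icc 0 L) x)
    (h₂ : ∀ x ∈ Icc 0 L, HasDerivWithinAt d₁ (d₂ x) (Icc 0 L) x)
    (h0 : d 0 = 0) (hL : d L = 0) (hd : ∀ x ∈ Icc 0 L, d₂ x ≤ 0) :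
    ∀ x ∈ Icc 0 L, 0 ≤ d x := by
  intro x hx
  have := nonpos_of_monotoneOn_deriv (fun y hy => (h₁ y hy).neg)
    (monotoneOn_of_hasDerivWithinAt_nonneg (fun y hy => (h₂ y hy).neg)
      (fun y hy => neg_nonneg.2 (hd y hy))) (by simp [h0]) (by simp [hL]) x hx
  simpa using this

theorem le_of_deriv2_ge {d d₁ d₂ : ℝ → ℝ} {L R : ℝ} (hR : 0 ≤ R)
    (h₁ : ∀ x ∈ Icc 0 L, HasDerivWithinAt d (d₁ x) (Icc 0 L) x)
    (h₂ : ∀ x ∈ Icc 0 L, HasDerivWithinAt d₁ (d₂ x) (Icc 0 L) x)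
    (h0 : d 0 = 0) (hL : d L = 0) (hd : ∀ x ∈ Icc 0 L, -R ≤ d₂ x) :
    ∀ x ∈ Icc 0 L, d x ≤ R * (L ^ 2 / 8) := by
  refine le_of_monotoneOn_deriv_add h₁ hR ?_ h0 hL
  refine monotoneOn_of_hasDerivWithinAt_nonneg (f' := fun x => d₂ x + R * 1) (fun y hy =>
    (h₂ y hy).add ((hasDerivAt_id y).const_mul R).hasDerivWithinAt) (fun y hy => ?_)
  have := hd y hy
  linarith

/-- If `u` vanishes at both ends and `-u'' ≤ R` almost everywhere then `u ≤ R L² / 8`. -/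
theorem le_of_ae_deriv2_ge {u u₁ : ℝ → ℝ} {L R : ℝ} (hL : 0 < L) (hR : 0 ≤ R)
    (hu : ∀ x ∈ Icc 0 L, HasDerivWithinAt u (u₁ x) (Icc 0 L) x)
    (hac : AbsolutelyContinuousOnInterval u₁ 0 L)
    (h0 : u 0 = 0) (h1 : u L = 0) (hd : ∀ᵐ x, x ∈ Ioo 0 L → -R ≤ deriv u₁ x) :
    ∀ x ∈ Icc 0 L, u x ≤ R * (L ^ 2 / 8) := by
  refine le_of_monotoneOn_deriv_add hu hR ?_ h0 h1
  have hlin : AbsolutelyContinuousOnInterval (fun x : ℝ => R * x) 0 L :=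
    absolutelyContinuous_of_hasDerivWithinAt hL.le (f' := fun _ => R * 1)
      (fun y _ => ((hasDerivAt_id y).const_mul R).hasDerivWithinAt) continuousOn_const
  refine monotoneOn_of_ae_deriv_nonneg hL (hac.add hlin) ?_
  filter_upwards [hd, hac.ae_differentiableAt] with x hx hdx hxL
  rw [uIcc_of_le hL.le] at hdx
  have := (hdx (Ioo_subset_Icc_self hxL)).hasDerivAt.add ((hasDerivAt_id x).const_mul R)
  have e : deriv (fun x => u₁ x + R * x) x = deriv u₁ x + R * 1 := this.deriv
  rw [e]
  linarith [hx hxL]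

/-! ### Integration by parts -/

/-- The integrand is almost everywhere the derivative of the absolutely continuous function `g₁ u -
g u₁`. This form allows `u''` to exist only almost everywhere, as it does when `u = -y''` with `y`
in `W^{4,1}`. -/
theorem integral_wronskian {g g₁ g₂ u u₁ : ℝ → ℝ} {s t : ℝ} (hst : s ≤ t)
    (hg : ∀ x, HasDerivAt g (g₁ x) x) (hg₁ : ∀ x, HasDerivAt g₁ (g₂ x) x) (hg₂ : Continuous g₂)
    (hu : ∀ x ∈ Icc s t, HasDerivWithinAt u (u₁ x) (Icc s t) x)
    (hac : AbsolutelyContinuousOnInterval u₁ s t) :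
    ∫ x in s..t, (g₂ x * u x - g x * deriv u₁ x) =
      (g₁ t * u t - g t * u₁ t) - (g₁ s * u s - g s * u₁ s) := by
  have cg₁ : Continuous g₁ := continuous_iff_continuousAt.2 fun x => (hg₁ x).continuousAt
  have ag : AbsolutelyContinuousOnInterval g s t := absolutelyContinuous_of_hasDerivWithinAt hst
    (fun x _ => (hg x).hasDerivWithinAt) cg₁.continuousOn
  have ag₁ : AbsolutelyContinuousOnInterval g₁ s t := absolutelyContinuous_of_hasDerivWithinAt hst
    (fun x _ => (hg₁ x).hasDerivWithinAt) hg₂.continuousOn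
  have cu₁ := hac.continuousOn
  rw [uIcc_of_le hst] at cu₁
  have au : AbsolutelyContinuousOnInterval u s t :=
    absolutelyContinuous_of_hasDerivWithinAt hst hu cu₁
  have := ((ag₁.mul au).sub (ag.mul hac)).integral_deriv_eq_sub
  simp only [Pi.sub_apply, Pi.mul_apply] at this
  rw [← this]
  refine intervalIntegral.integral_congr_ae ?_
  have eL : ∀ᵐ x : ℝ, x ≠ t := by simp [ae_iff]
  filter_upwards [hac.ae_differentiableAt, eL] with x hx hxt hxI
  rw [uIoc_of_le hst] at hxI
  rw [uIcc_of_le hst] at hx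
  have hxI' : x ∈ Icc s t := Ioc_subset_Icc_self hxI
  have hu' : HasDerivAt u (u₁ x) x :=
    (hu x hxI').hasDerivAt (Icc_mem_nhds hxI.1 (lt_of_le_of_ne hxI.2 hxt))
  rw [(((hg₁ x).mul hu').sub ((hg x).mul (hx hxI').hasDerivAt)).deriv]
  ring

/-- For `y` vanishing at both ends, `∫ y = -∫ x (L - x) / 2 * y''`. -/
theorem integral_eq_neg_integral_parabola_mul {y y₁ y₂ : ℝ → ℝ} {L : ℝ} (hL : 0 < L)
    (h₁ : ∀ x ∈ Icc 0 L, HasDerivWithinAt y (y₁ x) (Icc 0 L) x)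
    (h₂ : ∀ x ∈ Icc 0 L, HasDerivWithinAt y₁ (y₂ x) (Icc 0 L) x)
    (c₂ : ContinuousOn y₂ (Icc 0 L)) (y0 : y 0 = 0) (yL : y L = 0) :
    ∫ x in (0 : ℝ)..L, y x = -∫ x in (0 : ℝ)..L, x * (L - x) / 2 * y₂ x := by
  have hw := integral_wronskian (g := fun x => 1 * (x * (L - x) / 2)) hL.le
    (fun x => hasDerivAt_parabola L 1 x)
    (fun x => ((hasDerivAt_id x).const_sub (L / 2)).const_mul 1) continuous_const h₁
    (absolutelyContinuous_of_hasDerivWithinAt hL.le h₂ c₂)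
  simp only [y0, yL, sub_self, mul_zero, zero_mul, zero_div, one_mul] at hw
  have hy : ContinuousOn y (Icc 0 L) := fun x hx => (h₁ x hx).continuousWithinAt
  rw [← uIcc_of_le hL.le] at hy c₂
  have e : ∫ x in (0 : ℝ)..L, (-1 * y x - x * (L - x) / 2 * deriv y₁ x) =
      ∫ x in (0 : ℝ)..L, (-y x - x * (L - x) / 2 * y₂ x) := by
    refine intervalIntegral.integral_congr_ae ?_
    have eL : ∀ᵐ x : ℝ, x ≠ L := by simp [ae_iff]
    filter_upwards [eL] with x hxL hx
    rw [uIoc_of_le hL.le] at hx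
    rw [((h₂ x (Ioc_subset_Icc_self hx)).hasDerivAt
      (Icc_mem_nhds hx.1 (lt_of_le_of_ne hx.2 hxL))).deriv]
    ring
  rw [e, intervalIntegral.integral_sub (f := fun x => -y x) hy.neg.intervalIntegrable
    (ContinuousOn.intervalIntegrable (by fun_prop)), intervalIntegral.integral_neg] at hw
  linarith

/-! ### Hyperbolic inequalities -/

theorem sinh_lt_mul_cosh {w : ℝ} (hw : 0 < w) : Real.sinh w < w * Real.cosh w := by
  have h : StrictMonoOn (fun w => w * Real.cosh w - Real.sinh w) (Ici 0) := by
    refine strictMonoOn_of_deriv_pos (convex_Ici 0) (by fun_prop) ?_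
    intro x hx
    rw [interior_Ici] at hx
    have : HasDerivAt (fun w => w * Real.cosh w - Real.sinh w)
        (1 * Real.cosh x + x * Real.sinh x - Real.cosh x) x :=
      ((hasDerivAt_id x).mul (Real.hasDerivAt_cosh x)).sub (Real.hasDerivAt_sinh x)
    rw [this.deriv]
    have : 0 < x * Real.sinh x := mul_pos hx (Real.sinh_pos_iff.2 hx)
    linarith
  have := h (mem_Ici.2 le_rfl) (mem_Ici.2 hw.le) hw
  simp only [Real.sinh_zero] at this
  linarith

/-- By the half-angle formulas this is `sinh w < w cosh w` at `w = z / 2`, multiplied by `2 sinh w`.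
-/
theorem cosh_sub_one_lt {z : ℝ} (hz : 0 < z) : Real.cosh z - 1 < z / 2 * Real.sinh z := by
  have h1 := sinh_lt_mul_cosh (half_pos hz)
  have h2 := Real.sinh_pos_iff.2 (half_pos hz)
  have e : z = 2 * (z / 2) := by ring
  have e1 : Real.cosh z = 2 * Real.sinh (z / 2) ^ 2 + 1 := by
    conv_lhs => rw [e, Real.cosh_two_mul, Real.cosh_sq]
    ring
  have e2 : Real.sinh z = 2 * Real.sinh (z / 2) * Real.cosh (z / 2) := by
    conv_lhs => rw [e, Real.sinh_two_mul]
  rw [e1, e2]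
  nlinarith

theorem cosh_sub_one_le {z : ℝ} (hz : 0 ≤ z) : Real.cosh z - 1 ≤ z / 2 * Real.sinh z := by
  rcases hz.eq_or_lt with rfl | h
  · simp
  · exact (cosh_sub_one_lt h).le

theorem sinh_add_sinh_le {x y : ℝ} (hx : 0 ≤ x) (hy : 0 ≤ y) :
    Real.sinh x + Real.sinh y ≤ Real.sinh (x + y) := by
  rw [Real.sinh_add]
  nlinarith [Real.one_le_cosh x, Real.one_le_cosh y, Real.sinh_nonneg_iff.2 hx,
    Real.sinh_nonneg_iff.2 hy]

/-- A multiple of the solution of `-ψ'' + k² ψ = 1`, `ψ(0) = ψ(L) = 0`. -/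
noncomputable def torsion (k L x : ℝ) : ℝ :=
  Real.sinh (k * L) - Real.sinh (k * (L - x)) - Real.sinh (k * x)

/-- A multiple of the solution of `-Φ'' + k² Φ = x (L - x) / 2`, `Φ(0) = Φ(L) = 0`. -/
noncomputable def torsionParabola (k L x : ℝ) : ℝ :=
  k ^ 2 * Real.sinh (k * L) * (x * (L - x) / 2) - torsion k L x

theorem torsion_symm (k L x : ℝ) : torsion k L (L - x) = torsion k L x := by
  simp only [torsion, sub_sub_cancel]; ring

theorem torsionParabola_symm (k L x : ℝ) :
    torsionParabola k L (L - x) = torsionParabola k L x := by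
  simp only [torsionParabola, torsion_symm]; ring

theorem torsion_nonneg {k L x : ℝ} (hk : 0 < k) (hx : x ∈ Icc 0 L) : 0 ≤ torsion k L x := by
  have := sinh_add_sinh_le (mul_nonneg hk.le (sub_nonneg.2 hx.2)) (mul_nonneg hk.le hx.1)
  rw [show k * (L - x) + k * x = k * L by ring] at this
  simp only [torsion]; linarith

theorem torsion_eq (k L x : ℝ) : torsion k L x =
    Real.sinh (k * L) * (1 - Real.cosh (k * x)) + (Real.cosh (k * L) - 1) * Real.sinh (k * x) := by
  simp only [torsion, mul_sub, Real.sinh_sub]; ring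

/-- The factor of `sinh (k x)` is the limit of the quotient as `x → 0`, so it cannot be improved.
Reflection `x ↦ L - x` gives the companion bound by `sinh (k (L - x))`; the same applies to
`torsionParabola_le`. -/
theorem torsion_le {k L x : ℝ} (hk : 0 < k) (hL : 0 < L) :
    torsion k L x ≤ (Real.cosh (k * L) - 1) * Real.sinh (k * x) := by
  rw [torsion_eq]
  have : 0 < Real.sinh (k * L) := Real.sinh_pos_iff.2 (mul_pos hk hL)
  nlinarith [Real.one_le_cosh (k * x)]

theorem torsionParabola_le {k L x : ℝ} (hk : 0 < k) (hL : 0 < L) (hx : x ∈ Icc 0 L) :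
    torsionParabola k L x ≤
      (k * L / 2 * Real.sinh (k * L) - (Real.cosh (k * L) - 1)) * Real.sinh (k * x) := by
  rw [torsionParabola, torsion_eq]
  have hS : 0 < Real.sinh (k * L) := Real.sinh_pos_iff.2 (mul_pos hk hL)
  have hz : 0 ≤ k * x := mul_nonneg hk.le hx.1
  have h1 := cosh_sub_one_le hz
  have h2 : k * x ≤ Real.sinh (k * x) := Real.self_le_sinh_iff.2 hz
  have h3 : k * x ≤ k * L := mul_le_mul_of_nonneg_left hx.2 hk.le
  -- With `z = k x`, replacing `k L` by the smaller `z` reduces the claim to `cosh z - 1 ≤ z / 2 *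
  -- sinh z`.
  have h4 : 0 ≤ k * L / 2 * (Real.sinh (k * x) - k * x) + (k * x) ^ 2 / 2 + 1
      - Real.cosh (k * x) := by
    nlinarith [mul_nonneg (sub_nonneg.2 h3) (sub_nonneg.2 h2)]
  nlinarith [mul_nonneg hS.le h4]

theorem hasDerivAt_sinh_mul (k x : ℝ) :
    HasDerivAt (fun x => Real.sinh (k * x)) (k * Real.cosh (k * x)) x := by
  have := (Real.hasDerivAt_sinh (k * x)).comp x ((hasDerivAt_id x).const_mul k)
  exact this.congr_deriv (by ring)

theorem hasDerivAt_cosh_mul (k x : ℝ) :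
    HasDerivAt (fun x => Real.cosh (k * x)) (k * Real.sinh (k * x)) x := by
  have := (Real.hasDerivAt_cosh (k * x)).comp x ((hasDerivAt_id x).const_mul k)
  exact this.congr_deriv (by ring)

theorem hasDerivAt_sinh_mul_sub (k L x : ℝ) :
    HasDerivAt (fun x => Real.sinh (k * (L - x))) (-(k * Real.cosh (k * (L - x)))) x := by
  have := (Real.hasDerivAt_sinh (k * (L - x))).comp x
    (((hasDerivAt_id x).const_sub L).const_mul k)
  exact this.congr_deriv (by ring)

theorem hasDerivAt_cosh_mul_sub (k L x : ℝ) :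
    HasDerivAt (fun x => Real.cosh (k * (L - x))) (-(k * Real.sinh (k * (L - x)))) x := by
  have := (Real.hasDerivAt_cosh (k * (L - x))).comp x
    (((hasDerivAt_id x).const_sub L).const_mul k)
  exact this.congr_deriv (by ring)

/-! ### Green's function and the maximum principle -/

/-- Green's representation for `-u'' + k² u` with Dirichlet boundary conditions. -/
theorem green_representation {u u₁ : ℝ → ℝ} {k L x : ℝ} (hx : x ∈ Icc 0 L)
    (hu : ∀ x ∈ Icc 0 L, HasDerivWithinAt u (u₁ x) (Icc 0 L) x)
    (hac : AbsolutelyContinuousOnInterval u₁ 0 L) (u0 : u 0 = 0) (uL : u L = 0) :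
    Real.sinh (k * (L - x)) *
        (∫ s in (0 : ℝ)..x, Real.sinh (k * s) * (k ^ 2 * u s - deriv u₁ s)) +
      Real.sinh (k * x) *
        (∫ s in x..L, Real.sinh (k * (L - s)) * (k ^ 2 * u s - deriv u₁ s)) =
      k * Real.sinh (k * L) * u x := by
  have hL : 0 ≤ L := hx.1.trans hx.2
  -- Both `sinh (k s)` and `sinh (k (L - s))` solve `g'' = k² g`, and each vanishes at the outer end
  -- of its interval. After weighting, the `u₁ x` terms cancel.
  have hl := integral_wronskian (u := u) (u₁ := u₁) (g₂ := fun s => k * (k * Real.sinh (k * s)))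
    hx.1 (fun s => hasDerivAt_sinh_mul k s) (fun s => (hasDerivAt_cosh_mul k s).const_mul k)
    (by fun_prop) (fun y hy => (hu y ⟨hy.1, hy.2.trans hx.2⟩).mono (Icc_subset_Icc_right hx.2))
    (hac.mono (by rw [uIcc_of_le hx.1, uIcc_of_le hL]; exact Icc_subset_Icc_right hx.2))
  have hr := integral_wronskian (u := u) (u₁ := u₁)
    (g₂ := fun s => -(k * -(k * Real.sinh (k * (L - s)))))
    hx.2 (fun s => hasDerivAt_sinh_mul_sub k L s)
    (fun s => ((hasDerivAt_cosh_mul_sub k L s).const_mul k).neg)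
    (by fun_prop) (fun y hy => (hu y ⟨hx.1.trans hy.1, hy.2⟩).mono (Icc_subset_Icc_left hx.1))
    (hac.mono (by rw [uIcc_of_le hx.2, uIcc_of_le hL]; exact Icc_subset_Icc_left hx.1))
  have el : ∀ s, Real.sinh (k * s) * (k ^ 2 * u s - deriv u₁ s) =
      k * (k * Real.sinh (k * s)) * u s - Real.sinh (k * s) * deriv u₁ s := fun s => by ring
  have er : ∀ s, Real.sinh (k * (L - s)) * (k ^ 2 * u s - deriv u₁ s) =
      -(k * -(k * Real.sinh (k * (L - s)))) * u s - Real.sinh (k * (L - s)) * deriv u₁ s :=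
    fun s => by ring
  simp only [el, er]
  rw [hl, hr]
  have : Real.sinh (k * L) = Real.sinh (k * (L - x)) * Real.cosh (k * x) +
      Real.cosh (k * (L - x)) * Real.sinh (k * x) := by
    rw [← Real.sinh_add]; ring_nf
  rw [this]
  simp only [u0, uL, mul_zero, sub_self, Real.sinh_zero]
  ring

/-- The response to a constant source; it evaluates the contribution of `N I` in Green's
representation. -/
theorem green_integral {k L x : ℝ} (hk : 0 < k) :
    Real.sinh (k * (L - x)) * (∫ s in (0 : ℝ)..x, Real.sinh (k * s)) +
      Real.sinh (k * x) * (∫ s in x..L, Real.sinh (k * (L - s))) = torsion k L x / k := by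
  have hl : ∫ s in (0 : ℝ)..x, Real.sinh (k * s) =
      Real.cosh (k * x) / k - Real.cosh (k * 0) / k := by
    refine intervalIntegral.integral_eq_sub_of_hasDerivAt
      (f := fun s => Real.cosh (k * s) / k) (fun s _ => ?_)
      (Continuous.intervalIntegrable (by fun_prop) _ _)
    exact ((hasDerivAt_cosh_mul k s).div_const k).congr_deriv (by field_simp)
  have hr : ∫ s in x..L, Real.sinh (k * (L - s)) =
      -Real.cosh (k * (L - L)) / k - -Real.cosh (k * (L - x)) / k := by
    refine intervalIntegral.integral_eq_sub_of_hasDerivAt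
      (f := fun s => -Real.cosh (k * (L - s)) / k) (fun s _ => ?_)
      (Continuous.intervalIntegrable (by fun_prop) _ _)
    exact ((hasDerivAt_cosh_mul_sub k L s).neg.div_const k).congr_deriv (by field_simp)
  have : Real.sinh (k * L) = Real.sinh (k * (L - x)) * Real.cosh (k * x) +
      Real.cosh (k * (L - x)) * Real.sinh (k * x) := by
    rw [← Real.sinh_add]; ring_nf
  rw [hl, hr, torsion, this]
  simp only [sub_self, mul_zero, Real.cosh_zero]
  field_simp
  ring

theorem hasDerivAt_torsionParabola (k L x : ℝ) : HasDerivAt (torsionParabola k L)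
    (k ^ 2 * Real.sinh (k * L) * (L / 2 - x) -
      (k * Real.cosh (k * (L - x)) - k * Real.cosh (k * x))) x := by
  have := (hasDerivAt_parabola L (k ^ 2 * Real.sinh (k * L)) x).sub
    (((hasDerivAt_sinh_mul_sub k L x).const_sub (Real.sinh (k * L))).sub (hasDerivAt_sinh_mul k x))
  exact this.congr_deriv (by ring)

theorem integral_torsionParabola {k L : ℝ} (hk : 0 < k) :
    ∫ s in (0 : ℝ)..L, torsionParabola k L s =
      k ^ 2 * Real.sinh (k * L) * (L ^ 3 / 12) - L * Real.sinh (k * L)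
        + 2 * (Real.cosh (k * L) - 1) / k := by
  have := intervalIntegral.integral_eq_sub_of_hasDerivAt (a := 0) (b := L)
    (f := fun s => k ^ 2 * Real.sinh (k * L) * (L * s ^ 2 / 4 - s ^ 3 / 6) -
      (Real.sinh (k * L) * s + Real.cosh (k * (L - s)) / k - Real.cosh (k * s) / k))
    (f' := torsionParabola k L) (fun s _ => ?_) ?_
  · rw [this]
    simp only [sub_self, mul_zero, sub_zero, Real.cosh_zero]
    ring
  · have h := ((((hasDerivAt_pow 2 s).const_mul L).div_const 4).sub
      ((hasDerivAt_pow 3 s).div_const 6)).const_mul (k ^ 2 * Real.sinh (k * L))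
    have h' := (((hasDerivAt_id s).const_mul (Real.sinh (k * L))).add
      ((hasDerivAt_cosh_mul_sub k L s).div_const k)).sub ((hasDerivAt_cosh_mul k s).div_const k)
    refine (h.sub h').congr_deriv ?_
    simp only [torsionParabola, torsion]
    field_simp
    ring
  · refine Continuous.intervalIntegrable ?_ _ _
    exact continuous_iff_continuousAt.2 fun x => (hasDerivAt_torsionParabola k L x).continuousAt

/-- Self-adjointness of `-u'' + k² u`: applied to `torsionParabola` it gives `k⁴ sinh (k L)` times
the weight `s (L - s) / 2`. This is the test function that recovers the nonlocal term `∫ y` from the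
source. -/
theorem integral_torsionParabola_mul {u u₁ : ℝ → ℝ} {k L : ℝ} (hL : 0 < L)
    (hu : ∀ x ∈ Icc 0 L, HasDerivWithinAt u (u₁ x) (Icc 0 L) x)
    (hac : AbsolutelyContinuousOnInterval u₁ 0 L) (u0 : u 0 = 0) (uL : u L = 0) :
    ∫ s in (0 : ℝ)..L, torsionParabola k L s * (k ^ 2 * u s - deriv u₁ s) =
      k ^ 4 * Real.sinh (k * L) * ∫ s in (0 : ℝ)..L, s * (L - s) / 2 * u s := by
  have cF : Continuous (torsionParabola k L) :=
    continuous_iff_continuousAt.2 fun x => (hasDerivAt_torsionParabola k L x).continuousAt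
  have hw := integral_wronskian (g := torsionParabola k L)
    (g₂ := fun s => k ^ 2 * torsionParabola k L s
      - k ^ 4 * Real.sinh (k * L) * (s * (L - s) / 2)) hL.le
    (hasDerivAt_torsionParabola k L)
    (fun s => by
      have := (((hasDerivAt_id s).const_sub (L / 2)).const_mul (k ^ 2 * Real.sinh (k * L))).sub
        (((hasDerivAt_cosh_mul_sub k L s).const_mul k).sub ((hasDerivAt_cosh_mul k s).const_mul k))
      refine this.congr_deriv ?_
      simp only [torsionParabola, torsion]
      ring) (by fun_prop) hu hac
  have F0 : torsionParabola k L 0 = 0 := by simp [torsionParabola, torsion]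
  have FL : torsionParabola k L L = 0 := by simp [torsionParabola, torsion]
  simp only [u0, uL, F0, FL, mul_zero, zero_mul, sub_self] at hw
  have cu : ContinuousOn u (uIcc 0 L) := by
    rw [uIcc_of_le hL.le]; exact fun x hx => (hu x hx).continuousWithinAt
  have i1 : IntervalIntegrable
      (fun s => torsionParabola k L s * (k ^ 2 * u s - deriv u₁ s)) volume 0 L :=
    ((cu.intervalIntegrable.const_mul (k ^ 2)).sub hac.intervalIntegrable_deriv).continuousOn_mul
      cF.continuousOn
  have i2 : IntervalIntegrable (fun s => s * (L - s) / 2 * u s) volume 0 L :=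
    ContinuousOn.intervalIntegrable (by fun_prop)
  have e : ∀ s, (k ^ 2 * torsionParabola k L s - k ^ 4 * Real.sinh (k * L) * (s * (L - s) / 2))
      * u s - torsionParabola k L s * deriv u₁ s =
      torsionParabola k L s * (k ^ 2 * u s - deriv u₁ s)
        - k ^ 4 * Real.sinh (k * L) * (s * (L - s) / 2 * u s) := fun s => by ring
  simp only [e] at hw
  rw [intervalIntegral.integral_sub i1 (i2.const_mul _), intervalIntegral.integral_const_mul] at hw
  linarith

/-- The condition on `N` in the form in which the maximum principle uses it. -/
theorem kernel_condition {k L N : ℝ} (hk : 0 < k) (hL : 0 < L) (hN : 0 < N)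
    (h : N ≤ 4 * k ^ 2 / L ^ 3 * sigma (k * L)) :
    N * (Real.cosh (k * L) - 1) *
        (k * L / 2 * Real.sinh (k * L) - (Real.cosh (k * L) - 1)) / k ≤
      k ^ 4 * Real.sinh (k * L) + N * ∫ s in (0 : ℝ)..L, torsionParabola k L s := by
  rw [integral_torsionParabola hk]
  have hS : 0 < Real.sinh (k * L) := Real.sinh_pos_iff.2 (mul_pos hk hL)
  have hsq := Real.cosh_sq (k * L)
  rw [sigma] at h
  set S := Real.sinh (k * L)
  set C := Real.cosh (k * L)
  set E := 6 * (k * L) * C + 6 * (k * L) - 12 * S - (k * L) ^ 3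
  -- The positivity of the denominator of `sigma` is read off from `0 < N`. If `E ≤ 0`, including `E
  -- = 0` with quotient `0`, the hypothesis would give `N ≤ 0`.
  have hE : 0 < E := by
    by_contra hE
    have : 4 * k ^ 2 / L ^ 3 * (3 * (k * L) ^ 3 / E) ≤ 0 :=
      mul_nonpos_of_nonneg_of_nonpos (by positivity)
        (div_nonpos_of_nonneg_of_nonpos (by positivity) (not_lt.1 hE))
    linarith
  have h' : N * E ≤ 12 * k ^ 5 := by
    have : 4 * k ^ 2 / L ^ 3 * (3 * (k * L) ^ 3 / E) = 12 * k ^ 5 / E := by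
      field_simp; ring
    rw [this, le_div_iff₀ hE] at h
    exact h
  have h2 := mul_le_mul_of_nonneg_left h' hS.le
  -- After `C² = S² + 1` the difference of the two sides is a positive multiple of `12 k⁵ - N E`, so
  -- the lemma is exactly the hypothesis on `N`.
  have key : k ^ 4 * S + N * (k ^ 2 * S * (L ^ 3 / 12) - L * S + 2 * (C - 1) / k) -
      N * (C - 1) * (k * L / 2 * S - (C - 1)) / k = (S * (12 * k ^ 5) - S * (N * E)) / (12 * k) := by
    simp only [E]
    field_simp
    linear_combination (24 * N) * hsq
  have : 0 ≤ (S * (12 * k ^ 5) - S * (N * E)) / (12 * k) :=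
    div_nonneg (sub_nonneg.2 h2) (by positivity)
  linarith

/-- The maximum principle for `y'''' - M y'' + N ∫ y` with Navier boundary conditions. -/
theorem deriv2_nonpos_of_linOp_nonneg {L M N : ℝ} {y y₁ y₂ y₃ : ℝ → ℝ}
    (hL : 0 < L) (hM : 0 < M) (hN : 0 < N)
    (hNM : N ≤ 4 * M / L ^ 3 * sigma (Real.sqrt M * L))
    (h₁ : ∀ x ∈ Icc 0 L, HasDerivWithinAt y (y₁ x) (Icc 0 L) x)
    (h₂ : ∀ x ∈ Icc 0 L, HasDerivWithinAt y₁ (y₂ x) (Icc 0 L) x)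
    (h₃ : ∀ x ∈ Icc 0 L, HasDerivWithinAt y₂ (y₃ x) (Icc 0 L) x)
    (hac : AbsolutelyContinuousOnInterval y₃ 0 L)
    (y0 : y 0 = 0) (yL : y L = 0) (y20 : y₂ 0 = 0) (y2L : y₂ L = 0)
    (hy : ∀ᵐ x, x ∈ Ioo 0 L → 0 ≤ deriv y₃ x - M * y₂ x + N * ∫ t in (0 : ℝ)..L, y t) :
    ∀ x ∈ Icc 0 L, y₂ x ≤ 0 := by
  intro x hx
  obtain ⟨k, hk, rfl⟩ : ∃ k : ℝ, 0 < k ∧ M = k ^ 2 :=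
    ⟨Real.sqrt M, Real.sqrt_pos.2 hM, (Real.sq_sqrt hM.le).symm⟩
  rw [Real.sqrt_sq hk.le] at hNM
  have hker := kernel_condition hk hL hN hNM
  have c₂ : ContinuousOn y₂ (Icc 0 L) := fun x hx => (h₃ x hx).continuousWithinAt
  have hI := integral_eq_neg_integral_parabola_mul hL h₁ h₂ c₂ y0 yL
  set I := ∫ t in (0 : ℝ)..L, y t
  have hu : ∀ x ∈ Icc 0 L, HasDerivWithinAt (fun x => -y₂ x) (-y₃ x) (Icc 0 L) x :=
    fun x hx => (h₃ x hx).neg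
  have hac' : AbsolutelyContinuousOnInterval (fun x => -y₃ x) 0 L := hac.neg
  have u0 : -y₂ 0 = 0 := by simp [y20]
  have uL : -y₂ L = 0 := by simp [y2L]
  have G1 := green_representation (k := k) hx hu hac' u0 uL
  have G2 := integral_torsionParabola_mul (k := k) hL hu hac' u0 uL
  have G3 := green_integral (L := L) (x := x) hk
  set f : ℝ → ℝ := fun s => k ^ 2 * -y₂ s - deriv (fun x => -y₃ x) s with hf
  have hfI : IntervalIntegrable f volume 0 L := by
    have : IntervalIntegrable (fun s => -y₂ s) volume 0 L := by
      refine ContinuousOn.intervalIntegrable ?_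
      rw [uIcc_of_le hL.le]; exact c₂.neg
    exact (this.const_mul (k ^ 2)).sub hac'.intervalIntegrable_deriv
  set h : ℝ → ℝ := fun s => f s + N * I with hh
  have hhI : IntervalIntegrable h volume 0 L := hfI.add intervalIntegrable_const
  have hpos : ∀ᵐ s, s ∈ Ioo 0 L → 0 ≤ h s := by
    filter_upwards [hy] with s hs hsL
    have := hs hsL
    simp only [hh, hf, deriv.fun_neg]
    linarith
  have cF : Continuous (torsionParabola k L) :=
    continuous_iff_continuousAt.2 fun x => (hasDerivAt_torsionParabola k L x).continuousAt
  have hxl : uIcc 0 x ⊆ uIcc 0 L := by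
    rw [uIcc_of_le hx.1, uIcc_of_le hL.le]; exact Icc_subset_Icc_right hx.2
  have hxr : uIcc x L ⊆ uIcc 0 L := by
    rw [uIcc_of_le hx.2, uIcc_of_le hL.le]; exact Icc_subset_Icc_left hx.1
  have hhl := hhI.mono_set hxl
  have hhr := hhI.mono_set hxr
  have il : IntervalIntegrable (fun s => Real.sinh (k * s) * h s) volume 0 x :=
    hhl.continuousOn_mul (by fun_prop)
  have ir : IntervalIntegrable (fun s => Real.sinh (k * (L - s)) * h s) volume x L :=
    hhr.continuousOn_mul (by fun_prop)
  have iFl : IntervalIntegrable (fun s => torsionParabola k L s * h s) volume 0 x :=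
    hhl.continuousOn_mul cF.continuousOn
  have iFr : IntervalIntegrable (fun s => torsionParabola k L s * h s) volume x L :=
    hhr.continuousOn_mul cF.continuousOn
  have el : ∫ s in (0 : ℝ)..x, Real.sinh (k * s) * f s =
      (∫ s in (0 : ℝ)..x, Real.sinh (k * s) * h s)
        - N * I * ∫ s in (0 : ℝ)..x, Real.sinh (k * s) := by
    rw [← intervalIntegral.integral_const_mul, ← intervalIntegral.integral_sub il
      (Continuous.intervalIntegrable (by fun_prop) _ _)]
    congr 1; ext s; simp only [hh]; ring
  have er : ∫ s in x..L, Real.sinh (k * (L - s)) * f s =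
      (∫ s in x..L, Real.sinh (k * (L - s)) * h s)
        - N * I * ∫ s in x..L, Real.sinh (k * (L - s)) := by
    rw [← intervalIntegral.integral_const_mul, ← intervalIntegral.integral_sub ir
      (Continuous.intervalIntegrable (by fun_prop) _ _)]
    congr 1; ext s; simp only [hh]; ring
  have eF : ∫ s in (0 : ℝ)..L, torsionParabola k L s * f s =
      (∫ s in (0 : ℝ)..x, torsionParabola k L s * h s)
        + (∫ s in x..L, torsionParabola k L s * h s)
        - N * I * ∫ s in (0 : ℝ)..L, torsionParabola k L s := by
    rw [intervalIntegral.integral_add_adjacent_intervals iFl iFr,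
      ← intervalIntegral.integral_const_mul, ← intervalIntegral.integral_sub (iFl.trans iFr)
      (Continuous.intervalIntegrable (by fun_prop) _ _)]
    congr 1; ext s; simp only [hh]; ring
  have eI : ∫ s in (0 : ℝ)..L, s * (L - s) / 2 * -y₂ s = I := by
    rw [hI, ← intervalIntegral.integral_neg]
    congr 1; ext s; ring
  rw [el, er] at G1
  rw [eF, eI] at G2
  have hS : 0 < Real.sinh (k * L) := Real.sinh_pos_iff.2 (mul_pos hk hL)
  have hC : 0 < Real.cosh (k * L) - 1 := sub_pos.2 (Real.one_lt_cosh.2 (mul_pos hk hL).ne')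
  have hd := sub_pos.2 (cosh_sub_one_lt (mul_pos hk hL))
  -- `G2` now says `A I = ∫ torsionParabola * h`. Eliminating `I` from `G1` after multiplication by
  -- `A` leaves only integrals of `h`.
  set A := k ^ 4 * Real.sinh (k * L) + N * ∫ s in (0 : ℝ)..L, torsionParabola k L s with hA
  have hA0 : 0 < A := lt_of_lt_of_le (by positivity) hker
  have hτ := torsion_nonneg hk hx
  -- Nonnegativity of the kernel on both sides of the diagonal at once: `τ₁ τ₂` is `sinh (k (L - x))
  -- sinh (k s)` for `s ≤ x` and `sinh (k x) sinh (k (L - s))` for `x ≤ s`.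
  have kernel : ∀ s τ₁ τ₂ : ℝ, 0 ≤ τ₁ → 0 ≤ τ₂ →
      torsion k L x ≤ (Real.cosh (k * L) - 1) * τ₁ →
      torsionParabola k L s ≤
        (k * L / 2 * Real.sinh (k * L) - (Real.cosh (k * L) - 1)) * τ₂ →
      0 ≤ A * (τ₁ * τ₂) - N * (torsion k L x / k) * torsionParabola k L s := by
    intro s τ₁ τ₂ hτ₁ hτ₂ b₁ b₂
    have b : torsion k L x * torsionParabola k L s ≤ ((Real.cosh (k * L) - 1) * τ₁) *
        ((k * L / 2 * Real.sinh (k * L) - (Real.cosh (k * L) - 1)) * τ₂) :=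
      (mul_le_mul_of_nonneg_left b₂ hτ).trans
        (mul_le_mul_of_nonneg_right b₁ (mul_nonneg hd.le hτ₂))
    have b' := mul_le_mul_of_nonneg_right hker (mul_nonneg hτ₁ hτ₂)
    have b'' := mul_le_mul_of_nonneg_left b (div_pos hN hk).le
    have e1 : N * (torsion k L x / k) * torsionParabola k L s =
      N / k * (torsion k L x * torsionParabola k L s) := by ring
    rw [e1]
    refine sub_nonneg.2 (b''.trans (le_trans (le_of_eq ?_) b'))
    ring
  have e0 : ∀ᵐ x : ℝ, x ≠ 0 := by simp [ae_iff]
  have eL : ∀ᵐ x : ℝ, x ≠ L := by simp [ae_iff]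
  have Pl : 0 ≤ ∫ s in (0 : ℝ)..x, (A * (Real.sinh (k * (L - x)) * (Real.sinh (k * s) * h s))
      - N * (torsion k L x / k) * (torsionParabola k L s * h s)) := by
    refine intervalIntegral.integral_nonneg_of_ae_restrict hx.1 ?_
    rw [EventuallyLE, ae_restrict_iff' measurableSet_Icc]
    filter_upwards [hpos, e0, eL] with s hs h0 hL' hsx
    have hs1 : s ∈ Icc 0 L := ⟨hsx.1, hsx.2.trans hx.2⟩
    have := kernel s (Real.sinh (k * (L - x))) (Real.sinh (k * s))
      (Real.sinh_nonneg_iff.2 (mul_nonneg hk.le (sub_nonneg.2 hx.2)))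
      (Real.sinh_nonneg_iff.2 (mul_nonneg hk.le hsx.1))
      (by rw [← torsion_symm]; exact torsion_le hk hL) (torsionParabola_le hk hL hs1)
    have := mul_nonneg this (hs ⟨lt_of_le_of_ne hs1.1 (Ne.symm h0), lt_of_le_of_ne hs1.2 hL'⟩)
    simp only [Pi.zero_apply]
    linarith
  have Pr : 0 ≤ ∫ s in x..L, (A * (Real.sinh (k * x) * (Real.sinh (k * (L - s)) * h s))
      - N * (torsion k L x / k) * (torsionParabola k L s * h s)) := by
    refine intervalIntegral.integral_nonneg_of_ae_restrict hx.2 ?_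
    rw [EventuallyLE, ae_restrict_iff' measurableSet_Icc]
    filter_upwards [hpos, e0, eL] with s hs h0 hL' hsx
    have hs1 : s ∈ Icc 0 L := ⟨hx.1.trans hsx.1, hsx.2⟩
    have := kernel s (Real.sinh (k * x)) (Real.sinh (k * (L - s)))
      (Real.sinh_nonneg_iff.2 (mul_nonneg hk.le hx.1))
      (Real.sinh_nonneg_iff.2 (mul_nonneg hk.le (sub_nonneg.2 hsx.2)))
      (torsion_le hk hL)
      (by
        rw [← torsionParabola_symm]
        exact torsionParabola_le hk hL ⟨sub_nonneg.2 hs1.2, sub_le_self _ hs1.1⟩)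
    have := mul_nonneg this (hs ⟨lt_of_le_of_ne hs1.1 (Ne.symm h0), lt_of_le_of_ne hs1.2 hL'⟩)
    simp only [Pi.zero_apply]
    linarith
  rw [intervalIntegral.integral_sub ((il.const_mul _).const_mul _) (iFl.const_mul _)] at Pl
  rw [intervalIntegral.integral_sub ((ir.const_mul _).const_mul _) (iFr.const_mul _)] at Pr
  simp only [intervalIntegral.integral_const_mul] at Pl Pr
  set X := ∫ s in (0 : ℝ)..x, Real.sinh (k * s) * h s
  set Y := ∫ s in x..L, Real.sinh (k * (L - s)) * h s
  set Fl := ∫ s in (0 : ℝ)..x, torsionParabola k L s * h s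
  set Fr := ∫ s in x..L, torsionParabola k L s * h s
  have final : 0 ≤ (A * (k * Real.sinh (k * L))) * (-y₂ x) := by
    have : (A * (k * Real.sinh (k * L))) * (-y₂ x) =
        (A * (Real.sinh (k * (L - x)) * X) - N * (torsion k L x / k) * Fl) +
        (A * (Real.sinh (k * x) * Y) - N * (torsion k L x / k) * Fr) := by
      linear_combination (-A) * G1 - A * N * I * G3 + N * (torsion k L x / k) * G2
        + N * (torsion k L x / k) * I * hA
    rw [this]; exact add_nonneg Pl Pr
  have := nonneg_of_mul_nonneg_right final (by positivity)
  linarith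

/-! ### Jets of functions satisfying the Navier conditions -/

theorem absolutelyContinuous_congr {f g : ℝ → ℝ} {a b : ℝ}
    (hf : AbsolutelyContinuousOnInterval f a b) (h : EqOn f g (uIcc a b)) :
    AbsolutelyContinuousOnInterval g a b := by
  rw [absolutelyContinuousOnInterval_iff] at hf ⊢
  intro ε hε
  obtain ⟨δ, hδ, H⟩ := hf ε hε
  refine ⟨δ, hδ, fun E hE hs => ?_⟩
  have e : ∑ i ∈ Finset.range E.1, dist (g (E.2 i).1) (g (E.2 i).2) =
      ∑ i ∈ Finset.range E.1, dist (f (E.2 i).1) (f (E.2 i).2) :=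
    Finset.sum_congr rfl fun i hi => by rw [h (hE.1 i hi).1, h (hE.1 i hi).2]
  rw [e]
  exact H E hE hs

/-- `y₁, y₂, y₃` are the first three derivatives of `y` on `[0, L]`, the third one is absolutely
continuous, and `y` satisfies the Navier boundary conditions. -/
structure NavierJet (L : ℝ) (y y₁ y₂ y₃ : ℝ → ℝ) : Prop where
  deriv₁ : ∀ x ∈ Icc 0 L, HasDerivWithinAt y (y₁ x) (Icc 0 L) x
  deriv₂ : ∀ x ∈ Icc 0 L, HasDerivWithinAt y₁ (y₂ x) (Icc 0 L) x
  deriv₃ : ∀ x ∈ Icc 0 L, HasDerivWithinAt y₂ (y₃ x) (Icc 0 L) x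
  ac : AbsolutelyContinuousOnInterval y₃ 0 L
  left : y 0 = 0
  right : y L = 0
  left₂ : y₂ 0 = 0
  right₂ : y₂ L = 0

theorem D_zero (L : ℝ) (y : ℝ → ℝ) : D L 0 y = y := iteratedDerivWithin_zero

theorem D_congr {L : ℝ} {y z : ℝ → ℝ} (k : ℕ) (h : EqOn y z (Icc 0 L)) :
    EqOn (D L k y) (D L k z) (Icc 0 L) := iteratedDerivWithin_congr h

theorem hasDerivWithinAt_D {L : ℝ} {y : ℝ → ℝ} {n k : ℕ} (hL : 0 < L)
    (hy : ContDiffOn ℝ n y (Icc 0 L)) (hk : k < n) :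
    ∀ x ∈ Icc 0 L, HasDerivWithinAt (D L k y) (D L (k + 1) y x) (Icc 0 L) x := by
  intro x hx
  rw [show D L (k + 1) y = derivWithin (D L k y) (Icc 0 L) from iteratedDerivWithin_succ]
  exact (hy.differentiableOn_iteratedDerivWithin (by exact_mod_cast hk)
    (uniqueDiffOn_Icc hL) x hx).hasDerivWithinAt

theorem D_succ_eqOn {L : ℝ} {y f f' : ℝ → ℝ} {k : ℕ} (hL : 0 < L)
    (h : EqOn (D L k y) f (Icc 0 L))
    (hf : ∀ x ∈ Icc 0 L, HasDerivWithinAt f (f' x) (Icc 0 L) x) :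
    EqOn (D L (k + 1) y) f' (Icc 0 L) := by
  intro x hx
  rw [show D L (k + 1) y = derivWithin (D L k y) (Icc 0 L) from iteratedDerivWithin_succ]
  exact ((hf x hx).congr h (h hx)).derivWithin (uniqueDiffOn_Icc hL x hx)

theorem D_four_eq {L x : ℝ} {y y₃ : ℝ → ℝ} (h : EqOn (D L 3 y) y₃ (Icc 0 L)) (hx : x ∈ Ioo 0 L) :
    D L 4 y x = deriv y₃ x := by
  rw [show D L 4 y = derivWithin (D L 3 y) (Icc 0 L) from iteratedDerivWithin_succ,
    derivWithin_of_mem_nhds (Icc_mem_nhds hx.1 hx.2)]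
  exact (h.eventuallyEq_of_mem (Icc_mem_nhds hx.1 hx.2)).deriv_eq

theorem contDiffOn_of_hasDerivWithinAt₂ {L : ℝ} {y y₁ y₂ : ℝ → ℝ} (hL : 0 < L)
    (h₁ : ∀ x ∈ Icc 0 L, HasDerivWithinAt y (y₁ x) (Icc 0 L) x)
    (h₂ : ∀ x ∈ Icc 0 L, HasDerivWithinAt y₁ (y₂ x) (Icc 0 L) x)
    (c₂ : ContinuousOn y₂ (Icc 0 L)) :
    ContDiffOn ℝ 2 y (Icc 0 L) ∧ EqOn (D L 2 y) y₂ (Icc 0 L) := by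
  have e₀ : EqOn (D L 0 y) y (Icc 0 L) := fun x _ => by rw [D_zero]
  have e₁ := D_succ_eqOn hL e₀ h₁
  have e₂ := D_succ_eqOn hL e₁ h₂
  refine ⟨?_, e₂⟩
  refine (contDiffOn_nat_iff_continuousOn_differentiableOn_deriv (n := 2)
    (uniqueDiffOn_Icc hL)).2 ⟨?_, ?_⟩
  · intro m hm
    interval_cases m
    · exact ContinuousOn.congr (fun x hx => (h₁ x hx).continuousWithinAt) e₀
    · exact ContinuousOn.congr (fun x hx => (h₂ x hx).continuousWithinAt) e₁
    · exact c₂.congr e₂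
  · intro m hm
    interval_cases m
    · exact DifferentiableOn.congr (fun x hx => (h₁ x hx).differentiableWithinAt) e₀
    · exact DifferentiableOn.congr (fun x hx => (h₂ x hx).differentiableWithinAt) e₁

namespace NavierJet

variable {L : ℝ} {y y₁ y₂ y₃ z z₁ z₂ z₃ : ℝ → ℝ}

theorem of_memW41 (hL : 0 < L) (hy : MemW41 L y) (hbc : NavierBC L y) :
    NavierJet L y (D L 1 y) (D L 2 y) (D L 3 y) where
  deriv₁ := by simpa only [D_zero] using hasDerivWithinAt_D (k := 0) (n := 3) hL hy.1 (by norm_num)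
  deriv₂ := hasDerivWithinAt_D (n := 3) hL hy.1 (by norm_num)
  deriv₃ := hasDerivWithinAt_D (n := 3) hL hy.1 (by norm_num)
  ac := hy.2
  left := hbc.1
  right := hbc.2.1
  left₂ := hbc.2.2.1
  right₂ := hbc.2.2.2

theorem continuousOn₂ (h : NavierJet L y y₁ y₂ y₃) : ContinuousOn y₂ (Icc 0 L) :=
  fun x hx => (h.deriv₃ x hx).continuousWithinAt

theorem continuousOn (h : NavierJet L y y₁ y₂ y₃) : ContinuousOn y (Icc 0 L) :=
  fun x hx => (h.deriv₁ x hx).continuousWithinAt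

theorem intervalIntegrable (hL : 0 < L) (h : NavierJet L y y₁ y₂ y₃) :
    IntervalIntegrable y volume 0 L := by
  refine ContinuousOn.intervalIntegrable ?_
  rw [uIcc_of_le hL.le]; exact h.continuousOn

theorem D_two_eqOn (hL : 0 < L) (h : NavierJet L y y₁ y₂ y₃) : EqOn (D L 2 y) y₂ (Icc 0 L) :=
  (contDiffOn_of_hasDerivWithinAt₂ hL h.deriv₁ h.deriv₂ h.continuousOn₂).2

theorem D_three_eqOn (hL : 0 < L) (h : NavierJet L y y₁ y₂ y₃) : EqOn (D L 3 y) y₃ (Icc 0 L) :=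
  D_succ_eqOn hL (h.D_two_eqOn hL) h.deriv₃

theorem memW41 (hL : 0 < L) (h : NavierJet L y y₁ y₂ y₃) : MemW41 L y := by
  have e₂ := h.D_two_eqOn hL
  have e₃ := h.D_three_eqOn hL
  have c₃ := h.ac.continuousOn
  have h2 := (contDiffOn_of_hasDerivWithinAt₂ hL h.deriv₁ h.deriv₂ h.continuousOn₂).1
  refine ⟨?_, absolutelyContinuous_congr h.ac (by rw [uIcc_of_le hL.le]; exact e₃.symm)⟩
  rw [uIcc_of_le hL.le] at c₃
  refine (contDiffOn_nat_succ_iff_contDiffOn_one_iteratedDerivWithin (n := 2)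
    (uniqueDiffOn_Icc hL)).2 ⟨h2, ?_⟩
  rw [contDiffOn_one_iff_derivWithin (uniqueDiffOn_Icc hL), ← iteratedDerivWithin_succ]
  exact ⟨DifferentiableOn.congr (fun x hx => (h.deriv₃ x hx).differentiableWithinAt) e₂,
    c₃.congr e₃⟩

theorem navierBC (hL : 0 < L) (h : NavierJet L y y₁ y₂ y₃) : NavierBC L y := by
  have e₂ := h.D_two_eqOn hL
  exact ⟨h.left, h.right, by rw [e₂ (left_mem_Icc.2 hL.le), h.left₂],
    by rw [e₂ (right_mem_Icc.2 hL.le), h.right₂]⟩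

theorem linOp_eq (hL : 0 < L) (h : NavierJet L y y₁ y₂ y₃) {M N x : ℝ} (hx : x ∈ Ioo 0 L) :
    linOp L M N y x = deriv y₃ x - M * y₂ x + N * ∫ t in (0 : ℝ)..L, y t := by
  rw [linOp, D_four_eq (h.D_three_eqOn hL) hx, h.D_two_eqOn hL (Ioo_subset_Icc_self hx)]

theorem sub (h : NavierJet L y y₁ y₂ y₃) (h' : NavierJet L z z₁ z₂ z₃) :
    NavierJet L (fun x => y x - z x) (fun x => y₁ x - z₁ x) (fun x => y₂ x - z₂ x)
      (fun x => y₃ x - z₃ x) where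
  deriv₁ x hx := (h.deriv₁ x hx).sub (h'.deriv₁ x hx)
  deriv₂ x hx := (h.deriv₂ x hx).sub (h'.deriv₂ x hx)
  deriv₃ x hx := (h.deriv₃ x hx).sub (h'.deriv₃ x hx)
  ac := h.ac.sub h'.ac
  left := by simp [h.left, h'.left]
  right := by simp [h.right, h'.right]
  left₂ := by simp [h.left₂, h'.left₂]
  right₂ := by simp [h.right₂, h'.right₂]

theorem const_mul (h : NavierJet L y y₁ y₂ y₃) (c : ℝ) :
    NavierJet L (fun x => c * y x) (fun x => c * y₁ x) (fun x => c * y₂ x)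
      (fun x => c * y₃ x) where
  deriv₁ x hx := (h.deriv₁ x hx).const_mul c
  deriv₂ x hx := (h.deriv₂ x hx).const_mul c
  deriv₃ x hx := (h.deriv₃ x hx).const_mul c
  ac := h.ac.const_mul c
  left := by simp [h.left]
  right := by simp [h.right]
  left₂ := by simp [h.left₂]
  right₂ := by simp [h.right₂]

theorem ae_deriv_sub (hL : 0 < L) (h : NavierJet L y y₁ y₂ y₃) (h' : NavierJet L z z₁ z₂ z₃) :
    ∀ᵐ x, x ∈ Ioo 0 L → deriv (fun x => y₃ x - z₃ x) x = deriv y₃ x - deriv z₃ x := by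
  filter_upwards [h.ac.ae_differentiableAt, h'.ac.ae_differentiableAt] with x hx hx' hxL
  rw [uIcc_of_le hL.le] at hx hx'
  exact ((hx (Ioo_subset_Icc_self hxL)).hasDerivAt.sub
    (hx' (Ioo_subset_Icc_self hxL)).hasDerivAt).deriv

theorem integral_sub (hL : 0 < L) (h : NavierJet L y y₁ y₂ y₃) (h' : NavierJet L z z₁ z₂ z₃) :
    ∫ t in (0 : ℝ)..L, (y t - z t) = (∫ t in (0 : ℝ)..L, y t) - ∫ t in (0 : ℝ)..L, z t :=
  intervalIntegral.integral_sub (h.intervalIntegrable hL) (h'.intervalIntegrable hL)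

end NavierJet

/-- Comparison principle for the linear operator `G`. -/
theorem comparison {L M N : ℝ} {y z : ℝ → ℝ}
    (hL : 0 < L) (hM : 0 < M) (hN : 0 < N)
    (hNM : N ≤ 4 * M / L ^ 3 * sigma (Real.sqrt M * L))
    (hy : MemW41 L y) (hy' : NavierBC L y) (hz : MemW41 L z) (hz' : NavierBC L z)
    (h : ∀ᵐ x, x ∈ Ioo 0 L → linOp L M N y x ≤ linOp L M N z x) :
    ∀ x ∈ Icc 0 L, y x ≤ z x ∧ D L 2 z x ≤ D L 2 y x := by
  have jy := NavierJet.of_memW41 hL hy hy'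
  have jz := NavierJet.of_memW41 hL hz hz'
  have j := jz.sub jy
  have h2 : ∀ x ∈ Icc 0 L, D L 2 z x - D L 2 y x ≤ 0 := by
    refine deriv2_nonpos_of_linOp_nonneg hL hM hN hNM j.deriv₁ j.deriv₂ j.deriv₃ j.ac
      j.left j.right j.left₂ j.right₂ ?_
    filter_upwards [h, jz.ae_deriv_sub hL jy] with x hx hd hxL
    have := hx hxL
    rw [jy.linOp_eq hL hxL, jz.linOp_eq hL hxL] at this
    rw [hd hxL, jz.integral_sub hL jy]
    linarith
  have h0 := nonneg_of_deriv2_nonpos j.deriv₁ j.deriv₂ j.left j.right h2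
  exact fun x hx => ⟨sub_nonneg.1 (h0 x hx), sub_nonpos.1 (h2 x hx)⟩

/-! ### Solvability of the linear problem -/

/-- Take a second primitive `q` of `h` vanishing at both ends and solve `y'' = k² y + q` with zero
end values by variation of parameters. Then `y''` vanishes at the ends automatically. -/
theorem exists_navierJet_of_integrable {L k : ℝ} (hL : 0 < L) (hk : 0 < k) {h : ℝ → ℝ}
    (hh : IntervalIntegrable h volume 0 L) :
    ∃ y y₁ y₂ y₃ : ℝ → ℝ, NavierJet L y y₁ y₂ y₃ ∧
      ∀ᵐ x, x ∈ Ioo 0 L → deriv y₃ x = k ^ 2 * y₂ x + h x := by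
  set f : ℝ → ℝ := (Ioc 0 L).indicator h with hf
  have hfint : Integrable f := by
    rw [hf, integrable_indicator_iff measurableSet_Ioc]
    exact (intervalIntegrable_iff_integrableOn_Ioc_of_le hL.le).1 hh
  have hfI : ∀ s t, IntervalIntegrable f volume s t := fun s t => hfint.intervalIntegrable
  set H₁ : ℝ → ℝ := fun x => ∫ s in (0 : ℝ)..x, f s with hH₁
  have cH₁ : Continuous H₁ := intervalIntegral.continuous_primitive hfI 0
  set H : ℝ → ℝ := fun x => ∫ s in (0 : ℝ)..x, H₁ s with hH
  have dH : ∀ x, HasDerivAt H (H₁ x) x := fun x => cH₁.integral_hasStrictDerivAt 0 x |>.hasDerivAt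
  set q : ℝ → ℝ := fun x => H x - x * (H L / L) with hq
  have dq : ∀ x, HasDerivAt q (H₁ x - 1 * (H L / L)) x := fun x =>
    (dH x).sub ((hasDerivAt_id x).mul_const _)
  have cq : Continuous q := continuous_iff_continuousAt.2 fun x => (dq x).continuousAt
  have q0 : q 0 = 0 := by simp [hq, hH]
  have qL : q L = 0 := by simp only [hq]; field_simp; ring
  have cP : Continuous fun s => Real.cosh (k * s) * q s := by fun_prop
  have cQ : Continuous fun s => Real.sinh (k * s) * q s := by fun_prop
  set P : ℝ → ℝ := fun x => ∫ s in (0 : ℝ)..x, Real.cosh (k * s) * q s with hP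
  set Q : ℝ → ℝ := fun x => ∫ s in (0 : ℝ)..x, Real.sinh (k * s) * q s with hQ
  have dP : ∀ x, HasDerivAt P (Real.cosh (k * x) * q x) x := fun x =>
    (cP.integral_hasStrictDerivAt 0 x).hasDerivAt
  have dQ : ∀ x, HasDerivAt Q (Real.sinh (k * x) * q x) x := fun x =>
    (cQ.integral_hasStrictDerivAt 0 x).hasDerivAt
  have hS : Real.sinh (k * L) ≠ 0 := (Real.sinh_pos_iff.2 (mul_pos hk hL)).ne'
  set c : ℝ := (Real.cosh (k * L) * Q L - Real.sinh (k * L) * P L) / (k * Real.sinh (k * L)) with hc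
  set y : ℝ → ℝ := fun x => (Real.sinh (k * x) * P x - Real.cosh (k * x) * Q x) / k
    + c * Real.sinh (k * x) with hy
  set y₁ : ℝ → ℝ := fun x => Real.cosh (k * x) * P x - Real.sinh (k * x) * Q x
    + c * (k * Real.cosh (k * x)) with hy₁
  have d₁ : ∀ x, HasDerivAt y (y₁ x) x := fun x => by
    have := ((((hasDerivAt_sinh_mul k x).mul (dP x)).sub
      ((hasDerivAt_cosh_mul k x).mul (dQ x))).div_const k).add
      ((hasDerivAt_sinh_mul k x).const_mul c)
    refine this.congr_deriv ?_
    simp only [hy₁]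
    field_simp
    ring
  have d₂ : ∀ x, HasDerivAt y₁ (k ^ 2 * y x + q x) x := fun x => by
    have := (((hasDerivAt_cosh_mul k x).mul (dP x)).sub
      ((hasDerivAt_sinh_mul k x).mul (dQ x))).add
      (((hasDerivAt_cosh_mul k x).const_mul k).const_mul c)
    refine this.congr_deriv ?_
    simp only [hy]
    field_simp
    linear_combination (q x) * Real.cosh_sq (k * x)
  have y0 : y 0 = 0 := by simp [hy, hQ]
  have yL : y L = 0 := by
    simp only [hy, hc]
    field_simp
    ring
  refine ⟨y, y₁, fun x => k ^ 2 * y x + q x,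
    fun x => k ^ 2 * y₁ x + (H₁ x - 1 * (H L / L)), ⟨fun x _ => (d₁ x).hasDerivWithinAt,
    fun x _ => (d₂ x).hasDerivWithinAt,
    fun x _ => (((d₁ x).const_mul (k ^ 2)).add (dq x)).hasDerivWithinAt, ?_, y0, yL,
    by simp [y0, q0], by simp [yL, qL]⟩, ?_⟩
  · have cy : Continuous y := continuous_iff_continuousAt.2 fun x => (d₁ x).continuousAt
    have a₁ : AbsolutelyContinuousOnInterval (fun x => k ^ 2 * y₁ x - 1 * (H L / L)) 0 L :=
      absolutelyContinuous_of_hasDerivWithinAt hL.le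
        (fun x _ => (((d₂ x).const_mul (k ^ 2)).sub_const _).hasDerivWithinAt)
        (Continuous.continuousOn (by fun_prop))
    have a₂ : AbsolutelyContinuousOnInterval H₁ 0 L :=
      (hfI 0 L).absolutelyContinuousOnInterval_intervalIntegral left_mem_uIcc
    exact absolutelyContinuous_congr (a₁.add a₂) fun x _ => by simp only [Pi.add_apply]; ring
  · filter_upwards [(hfI 0 L).ae_hasDerivAt_integral] with x hx hxL
    have hxI : x ∈ uIcc 0 L := by rw [uIcc_of_le hL.le]; exact Ioo_subset_Icc_self hxL
    have h1 : HasDerivAt H₁ (f x) x := hx hxI 0 left_mem_uIcc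
    have h2 := ((d₂ x).const_mul (k ^ 2)).add (h1.sub_const (1 * (H L / L)))
    have h3 : f x = h x := indicator_of_mem (Ioo_subset_Ioc_self hxL) h
    rw [← h3]
    exact h2.deriv

/-- Superposition: from the solution `y` of the local problem with source `h`, subtract a multiple
of the solution `z` with source `1` to absorb the constant `N ∫ y`. The multiple exists unless `1 +
N ∫ z = 0`; but then `G z = 0`, so `z = 0` on `[0, L]` by comparison, which is absurd. -/
theorem exists_linOp_eq {L M N : ℝ} (hL : 0 < L) (hM : 0 < M) (hN : 0 < N)
    (hNM : N ≤ 4 * M / L ^ 3 * sigma (Real.sqrt M * L)) {h : ℝ → ℝ}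
    (hh : IntervalIntegrable h volume 0 L) :
    ∃ y, MemW41 L y ∧ NavierBC L y ∧ ∀ᵐ x, x ∈ Ioo 0 L → linOp L M N y x = h x := by
  have hk := Real.sqrt_pos.2 hM
  obtain ⟨y, y₁, y₂, y₃, jy, ey⟩ := exists_navierJet_of_integrable hL hk hh
  obtain ⟨z, z₁, z₂, z₃, jz, ez⟩ := exists_navierJet_of_integrable hL hk
    (h := fun _ => 1) intervalIntegrable_const
  rw [Real.sq_sqrt hM.le] at ey ez
  have hne : 1 + N * ∫ t in (0 : ℝ)..L, z t ≠ 0 := by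
    intro h0
    have j0 : NavierJet L (fun _ => 0) (fun _ => 0) (fun _ => 0) (fun _ => 0) := by
      have := jz.const_mul 0
      simpa using this
    have hop : ∀ᵐ x, x ∈ Ioo 0 L → linOp L M N z x = linOp L M N (fun _ => 0) x := by
      filter_upwards [ez] with x hx hxL
      rw [jz.linOp_eq hL hxL, j0.linOp_eq hL hxL, hx hxL]
      simp only [deriv_const, intervalIntegral.integral_zero]
      linarith
    have c1 := comparison hL hM hN hNM (jz.memW41 hL) (jz.navierBC hL) (j0.memW41 hL)
      (j0.navierBC hL) (hop.mono fun x hx hxL => (hx hxL).le)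
    have c2 := comparison hL hM hN hNM (j0.memW41 hL) (j0.navierBC hL) (jz.memW41 hL)
      (jz.navierBC hL) (hop.mono fun x hx hxL => (hx hxL).ge)
    have : ∫ t in (0 : ℝ)..L, z t = ∫ t in (0 : ℝ)..L, (0 : ℝ) :=
      intervalIntegral.integral_congr fun x hx => by
        rw [uIcc_of_le hL.le] at hx
        exact le_antisymm (c1 x hx).1 (c2 x hx).1
    rw [this] at h0
    simp at h0
  set c := N * (∫ t in (0 : ℝ)..L, y t) / (1 + N * ∫ t in (0 : ℝ)..L, z t) with hc
  have jc := jz.const_mul c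
  have j := jy.sub jc
  refine ⟨_, j.memW41 hL, j.navierBC hL, ?_⟩
  filter_upwards [ey, ez, jy.ae_deriv_sub hL jc, jz.ac.ae_differentiableAt] with x hx hx' hd hz hxL
  rw [uIcc_of_le hL.le] at hz
  rw [j.linOp_eq hL hxL, hd hxL, jy.integral_sub hL jc, intervalIntegral.integral_const_mul,
    deriv_const_mul _ (hz (Ioo_subset_Icc_self hxL)), hx hxL, hx' hxL]
  have hc' : c * (1 + N * ∫ t in (0 : ℝ)..L, z t) = N * ∫ t in (0 : ℝ)..L, y t := by
    rw [hc]; field_simp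
  linear_combination -hc'

/-! ### The order and the iteration step -/

/-- The order `u ≼ v`: `u ≤ v` and `v'' ≤ u''` on `[0, L]`. -/
def Precedes (L : ℝ) (u v : ℝ → ℝ) : Prop :=
  ∀ x ∈ Icc 0 L, u x ≤ v x ∧ D L 2 v x ≤ D L 2 u x

theorem Precedes.trans {L : ℝ} {u v w : ℝ → ℝ} (h : Precedes L u v) (h' : Precedes L v w) :
    Precedes L u w := fun x hx =>
  ⟨(h x hx).1.trans (h' x hx).1, (h' x hx).2.trans (h x hx).2⟩

theorem Precedes.refl (L : ℝ) (u : ℝ → ℝ) : Precedes L u u := fun _ _ => ⟨le_rfl, le_rfl⟩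

theorem mem_orderInterval_iff {L : ℝ} {α β u : ℝ → ℝ} : u ∈ orderInterval L α β ↔
    ContDiffOn ℝ 2 u (Icc 0 L) ∧ Precedes L α u ∧ Precedes L u β := by
  simp only [orderInterval, Precedes, mem_ofPred_eq]
  grind

theorem MemW41.contDiffOn {L : ℝ} {y : ℝ → ℝ} (h : MemW41 L y) : ContDiffOn ℝ 2 y (Icc 0 L) :=
  h.1.of_le (by norm_num)

theorem intervalIntegrable_of_contDiffOn {L : ℝ} {y : ℝ → ℝ} (hL : 0 < L)
    (hy : ContDiffOn ℝ 2 y (Icc 0 L)) : IntervalIntegrable y volume 0 L := by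
  refine ContinuousOn.intervalIntegrable ?_
  rw [uIcc_of_le hL.le]; exact hy.continuousOn

theorem continuousOn_D_two {L : ℝ} {y : ℝ → ℝ} (hL : 0 < L)
    (hy : ContDiffOn ℝ 2 y (Icc 0 L)) : ContinuousOn (D L 2 y) (Icc 0 L) :=
  hy.continuousOn_iteratedDerivWithin (by norm_num) (uniqueDiffOn_Icc hL)

theorem integral_mono_of_precedes {L : ℝ} {u v : ℝ → ℝ} (hL : 0 < L)
    (hu : ContDiffOn ℝ 2 u (Icc 0 L)) (hv : ContDiffOn ℝ 2 v (Icc 0 L)) (h : Precedes L u v) :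
    ∫ t in (0 : ℝ)..L, u t ≤ ∫ t in (0 : ℝ)..L, v t :=
  intervalIntegral.integral_mono_on hL.le (intervalIntegrable_of_contDiffOn hL hu)
    (intervalIntegrable_of_contDiffOn hL hv) fun x hx => (h x hx).1

theorem precedes_of_D_two_le {L : ℝ} {u v : ℝ → ℝ} (hL : 0 < L)
    (hu : ContDiffOn ℝ 2 u (Icc 0 L)) (hv : ContDiffOn ℝ 2 v (Icc 0 L))
    (u0 : u 0 = 0) (uL : u L = 0) (v0 : v 0 = 0) (vL : v L = 0)
    (h : ∀ x ∈ Icc 0 L, D L 2 v x ≤ D L 2 u x) : Precedes L u v := by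
  have du := hasDerivWithinAt_D (n := 2) (k := 0) hL hu (by norm_num)
  have dv := hasDerivWithinAt_D (n := 2) (k := 0) hL hv (by norm_num)
  have du' := hasDerivWithinAt_D (n := 2) (k := 1) hL hu (by norm_num)
  have dv' := hasDerivWithinAt_D (n := 2) (k := 1) hL hv (by norm_num)
  simp only [D_zero] at du dv
  have := nonneg_of_deriv2_nonpos (fun x hx => (dv x hx).sub (du x hx))
    (fun x hx => (dv' x hx).sub (du' x hx)) (by simp [u0, v0]) (by simp [uL, vL])
    (fun x hx => sub_nonpos.2 (h x hx))
  exact fun x hx => ⟨sub_nonneg.1 (this x hx), h x hx⟩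

theorem sub_le_of_D_two_sub_le {L δ : ℝ} {u v : ℝ → ℝ} (hL : 0 < L) (hδ : 0 ≤ δ)
    (hu : ContDiffOn ℝ 2 u (Icc 0 L)) (hv : ContDiffOn ℝ 2 v (Icc 0 L))
    (e0 : u 0 = v 0) (eL : u L = v L)
    (h : ∀ x ∈ Icc 0 L, D L 2 u x - D L 2 v x ≤ δ) :
    ∀ x ∈ Icc 0 L, v x - u x ≤ δ * (L ^ 2 / 8) := by
  have du := hasDerivWithinAt_D (n := 2) (k := 0) hL hu (by norm_num)
  have dv := hasDerivWithinAt_D (n := 2) (k := 0) hL hv (by norm_num)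
  have du' := hasDerivWithinAt_D (n := 2) (k := 1) hL hu (by norm_num)
  have dv' := hasDerivWithinAt_D (n := 2) (k := 1) hL hv (by norm_num)
  simp only [D_zero] at du dv
  exact le_of_deriv2_ge hδ (fun x hx => (dv x hx).sub (du x hx))
    (fun x hx => (dv' x hx).sub (du' x hx)) (by simp [e0]) (by simp [eL])
    (fun x hx => by have := h x hx; linarith)

theorem exists_isStep {L a b c M N : ℝ} {p y : ℝ → ℝ} (hL : 0 < L) (hM : 0 < M) (hN : 0 < N)
    (hNM : N ≤ 4 * M / L ^ 3 * sigma (Real.sqrt M * L)) (hp : IntervalIntegrable p volume 0 L)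
    (hy : ContDiffOn ℝ 2 y (Icc 0 L)) : ∃ z, IsStep L a b c M N p y z := by
  refine exists_linOp_eq hL hM hN hNM ?_
  have h2 : IntervalIntegrable (D L 2 y) volume 0 L := by
    refine ContinuousOn.intervalIntegrable ?_
    rw [uIcc_of_le hL.le]; exact continuousOn_D_two hL hy
  exact ((((hp.add (h2.const_mul a)).add ((h2.const_mul b).mul_const _)).sub
    intervalIntegrable_const).sub (h2.const_mul M)).add intervalIntegrable_const

theorem IsStep.contDiffOn {L a b c M N : ℝ} {p y z : ℝ → ℝ} (h : IsStep L a b c M N p y z) :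
    ContDiffOn ℝ 2 z (Icc 0 L) := h.1.contDiffOn

theorem IsStep.eqOn {L a b c M N : ℝ} {p u v u' v' : ℝ → ℝ} (hL : 0 < L) (hM : 0 < M) (hN : 0 < N)
    (hNM : N ≤ 4 * M / L ^ 3 * sigma (Real.sqrt M * L)) (huv : EqOn u v (Icc 0 L))
    (hu : IsStep L a b c M N p u u') (hv : IsStep L a b c M N p v v') :
    EqOn u' v' (Icc 0 L) := by
  have e : ∫ t in (0 : ℝ)..L, u t = ∫ t in (0 : ℝ)..L, v t :=
    intervalIntegral.integral_congr (by rw [uIcc_of_le hL.le]; exact huv)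
  have h : ∀ᵐ x, x ∈ Ioo 0 L → linOp L M N u' x = linOp L M N v' x := by
    filter_upwards [hu.2.2, hv.2.2] with x h1 h2 hx
    rw [h1 hx, h2 hx, nonlin, nonlin, e, D_congr 2 huv (Ioo_subset_Icc_self hx)]
  have c1 := comparison hL hM hN hNM hu.1 hu.2.1 hv.1 hv.2.1 (h.mono fun x hx hxL => (hx hxL).le)
  have c2 := comparison hL hM hN hNM hv.1 hv.2.1 hu.1 hu.2.1 (h.mono fun x hx hxL => (hx hxL).ge)
  exact fun x hx => le_antisymm (c1 x hx).1 (c2 x hx).1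

/-- The terms in `M` and `N` cancel when input and output agree, so solutions are fixed points of
the step. -/
theorem isStep_self_of_isSolution {L a b c M N : ℝ} {p w : ℝ → ℝ}
    (h : IsSolution L a b c p w) : IsStep L a b c M N p w w := by
  refine ⟨h.1, h.2.1, ?_⟩
  filter_upwards [h.2.2] with x hx hxL
  have := hx hxL
  simp only [melanOp, linOp, nonlin] at this ⊢
  linarith

theorem isSolution_of_isStep_of_eqOn {L a b c M N : ℝ} {p w z : ℝ → ℝ} (hL : 0 < L)
    (h : IsStep L a b c M N p w z) (hwz : EqOn w z (Icc 0 L)) : IsSolution L a b c p z := by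
  refine ⟨h.1, h.2.1, ?_⟩
  have e : ∫ t in (0 : ℝ)..L, w t = ∫ t in (0 : ℝ)..L, z t :=
    intervalIntegral.integral_congr (by rw [uIcc_of_le hL.le]; exact hwz)
  filter_upwards [h.2.2] with x hx hxL
  have := hx hxL
  simp only [melanOp, linOp, nonlin, e, D_congr 2 hwz (Ioo_subset_Icc_self hxL)] at this ⊢
  linarith

/-- The standing hypotheses of the monotone iteration. -/
structure Admissible (L a b c M N : ℝ) (p α β : ℝ → ℝ) : Prop where
  hL : 0 < L
  hb : 0 < b
  hM : 0 < M
  hN : 0 < N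
  hNM : N ≤ 4 * M / L ^ 3 * sigma (Real.sqrt M * L)
  hp : IntervalIntegrable p volume 0 L
  lower : IsLowerSolution L a b c p α
  upper : IsUpperSolution L a b c p β
  order : Precedes L α β
  concave : ∀ x ∈ Icc 0 L, D L 2 α x ≤ 0
  le_M : a + b * (∫ x in (0 : ℝ)..L, β x) ≤ M
  le_N : ∀ x ∈ Icc 0 L, c - b * D L 2 β x ≤ N
  contr : M - (a + b * ∫ x in (0 : ℝ)..L, α x) + L ^ 3 / 4 * (N - c) < 4 / L ^ 2

namespace Admissible

variable {L a b c M N : ℝ} {p α β : ℝ → ℝ}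

theorem left_mem (S : Admissible L a b c M N p α β) : α ∈ orderInterval L α β :=
  mem_orderInterval_iff.2 ⟨S.lower.1.contDiffOn, Precedes.refl L α, S.order⟩

theorem right_mem (S : Admissible L a b c M N p α β) : β ∈ orderInterval L α β :=
  mem_orderInterval_iff.2 ⟨S.upper.1.contDiffOn, S.order, Precedes.refl L β⟩

theorem eq_zero_of_mem (S : Admissible L a b c M N p α β) {u : ℝ → ℝ}
    (hu : u ∈ orderInterval L α β) : u 0 = 0 ∧ u L = 0 := by
  have h := (mem_orderInterval_iff.1 hu).2
  have h0 := left_mem_Icc.2 S.hL.le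
  have hL := right_mem_Icc.2 S.hL.le
  exact ⟨le_antisymm ((h.2 0 h0).1.trans_eq S.upper.2.1.1)
      (S.lower.2.1.1.symm.trans_le (h.1 0 h0).1),
    le_antisymm ((h.2 L hL).1.trans_eq S.upper.2.1.2.1)
      (S.lower.2.1.2.1.symm.trans_le (h.1 L hL).1)⟩

theorem exists_step (S : Admissible L a b c M N p α β) {y : ℝ → ℝ}
    (hy : ContDiffOn ℝ 2 y (Icc 0 L)) : ∃ z, IsStep L a b c M N p y z :=
  exists_isStep S.hL S.hM S.hN S.hNM S.hp hy

/-- The iteration step is monotone on `[α, β]`. -/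
theorem step_mono (S : Admissible L a b c M N p α β) {u v u' v' : ℝ → ℝ}
    (hu : u ∈ orderInterval L α β) (hv : v ∈ orderInterval L α β) (huv : Precedes L u v)
    (hu' : IsStep L a b c M N p u u') (hv' : IsStep L a b c M N p v v') : Precedes L u' v' := by
  obtain ⟨cu, -, uβ⟩ := mem_orderInterval_iff.1 hu
  obtain ⟨cv, -, vβ⟩ := mem_orderInterval_iff.1 hv
  refine comparison S.hL S.hM S.hN S.hNM hu'.1 hu'.2.1 hv'.1 hv'.2.1 ?_
  have i1 := integral_mono_of_precedes S.hL cu cv huv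
  have i2 := integral_mono_of_precedes S.hL cv S.upper.1.contDiffOn vβ
  filter_upwards [hu'.2.2, hv'.2.2] with x h1 h2 hx
  have hx' := Ioo_subset_Icc_self hx
  rw [h1 hx, h2 hx, nonlin, nonlin]
  have d1 := (huv x hx').2
  have d2 := (uβ x hx').2
  have n1 : c - b * D L 2 u x ≤ N := by
    have := S.le_N x hx'
    have := mul_le_mul_of_nonneg_left d2 S.hb.le
    linarith
  have n2 : a + b * (∫ t in (0 : ℝ)..L, v t) ≤ M := by
    have := S.le_M
    have := mul_le_mul_of_nonneg_left i2 S.hb.le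
    linarith
  -- The right-hand sides for `v` and `u` differ by `(M - a - b ∫ v) (u'' - v'') + (N - c + b u'')
  -- (∫ v - ∫ u)`.
  have p1 := mul_nonneg (sub_nonneg.2 n2) (sub_nonneg.2 d1)
  have p2 := mul_nonneg (sub_nonneg.2 n1) (sub_nonneg.2 i1)
  linarith

theorem precedes_step (S : Admissible L a b c M N p α β) {α' : ℝ → ℝ}
    (h : IsStep L a b c M N p α α') : Precedes L α α' := by
  refine comparison S.hL S.hM S.hN S.hNM S.lower.1 S.lower.2.1 h.1 h.2.1 ?_
  filter_upwards [h.2.2, S.lower.2.2] with x h1 h2 hx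
  have := h2 hx
  rw [h1 hx]
  simp only [melanOp, linOp, nonlin] at this ⊢
  linarith

theorem step_precedes (S : Admissible L a b c M N p α β) {β' : ℝ → ℝ}
    (h : IsStep L a b c M N p β β') : Precedes L β' β := by
  refine comparison S.hL S.hM S.hN S.hNM h.1 h.2.1 S.upper.1 S.upper.2.1 ?_
  filter_upwards [h.2.2, S.upper.2.2] with x h1 h2 hx
  have := h2 hx
  rw [h1 hx]
  simp only [melanOp, linOp, nonlin] at this ⊢
  linarith

theorem step_mem (S : Admissible L a b c M N p α β) {u u' : ℝ → ℝ}
    (hu : u ∈ orderInterval L α β) (hu' : IsStep L a b c M N p u u') :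
    u' ∈ orderInterval L α β := by
  obtain ⟨α', hα'⟩ := S.exists_step S.lower.1.contDiffOn
  obtain ⟨β', hβ'⟩ := S.exists_step S.upper.1.contDiffOn
  obtain ⟨cu, αu, uβ⟩ := mem_orderInterval_iff.1 hu
  exact mem_orderInterval_iff.2 ⟨hu'.contDiffOn,
    (S.precedes_step hα').trans (S.step_mono S.left_mem hu αu hα' hu'),
    (S.step_mono hu S.right_mem uβ hu' hβ').trans (S.step_precedes hβ')⟩

/-- The iteration step halves the distance of the second derivatives of comparable functions. -/
theorem step_contr (S : Admissible L a b c M N p α β) {u v u' v' : ℝ → ℝ} {δ : ℝ} (hδ : 0 ≤ δ)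
    (hu : u ∈ orderInterval L α β) (hv : v ∈ orderInterval L α β) (huv : Precedes L u v)
    (hu' : IsStep L a b c M N p u u') (hv' : IsStep L a b c M N p v v')
    (h : ∀ x ∈ Icc 0 L, D L 2 u x - D L 2 v x ≤ δ) :
    ∀ x ∈ Icc 0 L, D L 2 u' x - D L 2 v' x ≤ δ / 2 := by
  have hL := S.hL
  obtain ⟨cu, αu, uβ⟩ := mem_orderInterval_iff.1 hu
  obtain ⟨cv, -, -⟩ := mem_orderInterval_iff.1 hv
  have ju := NavierJet.of_memW41 hL hu'.1 hu'.2.1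
  have jv := NavierJet.of_memW41 hL hv'.1 hv'.2.1
  have i1 := integral_mono_of_precedes hL cu cv huv
  have iα := integral_mono_of_precedes hL S.lower.1.contDiffOn cu αu
  have i1' := integral_mono_of_precedes hL hu'.contDiffOn hv'.contDiffOn
    (S.step_mono hu hv huv hu' hv')
  have hpre := S.step_mono hu hv huv hu' hv'
  have h2 : (∫ t in (0 : ℝ)..L, v t) - (∫ t in (0 : ℝ)..L, u t) ≤ δ * (L ^ 3 / 8) := by
    have hle := sub_le_of_D_two_sub_le hL hδ cu cv
      (by rw [(S.eq_zero_of_mem hu).1, (S.eq_zero_of_mem hv).1])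
      (by rw [(S.eq_zero_of_mem hu).2, (S.eq_zero_of_mem hv).2]) h
    rw [← intervalIntegral.integral_sub (intervalIntegrable_of_contDiffOn hL cv)
      (intervalIntegrable_of_contDiffOn hL cu)]
    refine (intervalIntegral.integral_mono_on hL.le ((intervalIntegrable_of_contDiffOn hL cv).sub
      (intervalIntegrable_of_contDiffOn hL cu)) (intervalIntegrable_const) hle).trans_eq ?_
    rw [intervalIntegral.integral_const, smul_eq_mul]
    ring
  set Iu := ∫ t in (0 : ℝ)..L, u t
  set Iv := ∫ t in (0 : ℝ)..L, v t
  set Iα := ∫ t in (0 : ℝ)..L, α t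
  -- At the endpoint `0` the boundary condition `β'' = 0` turns the bound on `N` into `c ≤ N`.
  have hNc : 0 ≤ N - c := by
    have h0 := left_mem_Icc.2 hL.le
    have := S.le_N 0 h0
    rw [S.upper.2.1.2.2.1] at this
    linarith
  have hm : 0 ≤ M - (a + b * Iα) := by
    have := S.le_M
    have := mul_le_mul_of_nonneg_left
      (integral_mono_of_precedes hL S.lower.1.contDiffOn S.upper.1.contDiffOn S.order) S.hb.le
    linarith
  -- For `d = u'''' - v''''` of the new iterates, the terms `M (u'' - v'')` and `N (∫ v - ∫ u)` of
  -- the new iterates are nonnegative by monotonicity, and `b u'' (∫ v - ∫ u)` of the old ones is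
  -- nonpositive by concavity. Dropping them leaves `-d ≤ R`, and the parabola bound then gives `R
  -- L² / 8`.
  set R := (M - (a + b * Iα)) * δ + (N - c) * (δ * (L ^ 3 / 8)) with hR
  have hR0 : 0 ≤ R := by positivity
  have hRle : R * (L ^ 2 / 8) ≤ δ / 2 := by
    have hc := S.contr.le
    have e : R ≤ (M - (a + b * Iα) + L ^ 3 / 4 * (N - c)) * δ := by
      have : 0 ≤ (N - c) * (δ * (L ^ 3 / 8)) := by positivity
      rw [hR]; linarith
    have e' : R ≤ 4 / L ^ 2 * δ := e.trans (mul_le_mul_of_nonneg_right hc hδ)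
    calc R * (L ^ 2 / 8) ≤ 4 / L ^ 2 * δ * (L ^ 2 / 8) :=
          mul_le_mul_of_nonneg_right e' (by positivity)
      _ = δ / 2 := by field_simp; ring
  have j := ju.sub jv
  intro x hx
  refine (le_of_ae_deriv2_ge hL hR0 j.deriv₃ j.ac j.left₂ j.right₂ ?_ x hx).trans hRle
  filter_upwards [hu'.2.2, hv'.2.2, ju.ae_deriv_sub hL jv] with s h1 h3 hd hs
  have hs' := Ioo_subset_Icc_self hs
  have e1 := h1 hs
  have e3 := h3 hs
  rw [ju.linOp_eq hL hs, nonlin] at e1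
  rw [jv.linOp_eq hL hs, nonlin] at e3
  rw [hd hs]
  have d1 := (huv s hs').2
  have d2 := h s hs'
  have d3 : D L 2 u s ≤ 0 := (αu s hs').2.trans (S.concave s hs')
  have d4 := (hpre s hs').2
  have m1 : M - (a + b * Iv) ≤ M - (a + b * Iα) := by
    have := mul_le_mul_of_nonneg_left (iα.trans i1) S.hb.le
    linarith
  have t1 : (M - (a + b * Iv)) * (D L 2 u s - D L 2 v s) ≤ (M - (a + b * Iα)) * δ :=
    (mul_le_mul_of_nonneg_right m1 (sub_nonneg.2 d1)).trans (mul_le_mul_of_nonneg_left d2 hm)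
  have t2 : (N - c) * (Iv - Iu) ≤ (N - c) * (δ * (L ^ 3 / 8)) := mul_le_mul_of_nonneg_left h2 hNc
  have t3 : b * D L 2 u s * (Iv - Iu) ≤ 0 :=
    mul_nonpos_of_nonpos_of_nonneg (mul_nonpos_of_nonneg_of_nonpos S.hb.le d3)
      (sub_nonneg.2 i1)
  have t4 : 0 ≤ M * (D L 2 u' s - D L 2 v' s) := mul_nonneg S.hM.le (sub_nonneg.2 d4)
  have t5 := mul_nonneg S.hN.le (sub_nonneg.2 i1')
  rw [hR]
  linarith

/-! ### The iteration -/

theorem exists_iteration (S : Admissible L a b c M N p α β) {y₀ : ℝ → ℝ}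
    (hy₀ : ContDiffOn ℝ 2 y₀ (Icc 0 L)) : ∃ y, IsIteration L a b c M N p y₀ y := by
  -- The recursion runs over the subtype of `C²` functions, since a next step is only available for
  -- those.
  choose T hT using fun y : {y : ℝ → ℝ // ContDiffOn ℝ 2 y (Icc 0 L)} => S.exists_step y.2
  let Y : ℕ → {y : ℝ → ℝ // ContDiffOn ℝ 2 y (Icc 0 L)} :=
    fun n => Nat.rec ⟨y₀, hy₀⟩ (fun _ y => ⟨T y, (hT y).contDiffOn⟩) n
  exact ⟨fun n => (Y n).1, rfl, fun n => hT (Y n)⟩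

theorem iteration_eqOn (S : Admissible L a b c M N p α β) {y₀ : ℝ → ℝ} {y z : ℕ → ℝ → ℝ}
    (hy : IsIteration L a b c M N p y₀ y) (hz : IsIteration L a b c M N p y₀ z) (n : ℕ) :
    EqOn (z n) (y n) (Icc 0 L) := by
  induction n with
  | zero => rw [hy.1, hz.1]; exact eqOn_refl _ _
  | succ n ih => exact IsStep.eqOn S.hL S.hM S.hN S.hNM ih (hz.2 n) (hy.2 n)

theorem iteration_mem (S : Admissible L a b c M N p α β) {y : ℕ → ℝ → ℝ}
    (h0 : y 0 ∈ orderInterval L α β) (hy : ∀ n, IsStep L a b c M N p (y n) (y (n + 1))) (n : ℕ) :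
    y n ∈ orderInterval L α β := by
  induction n with
  | zero => exact h0
  | succ n ih => exact S.step_mem ih (hy n)

theorem iteration_mono (S : Admissible L a b c M N p α β) {y z : ℕ → ℝ → ℝ}
    (hy0 : y 0 ∈ orderInterval L α β) (hz0 : z 0 ∈ orderInterval L α β)
    (hy : ∀ n, IsStep L a b c M N p (y n) (y (n + 1)))
    (hz : ∀ n, IsStep L a b c M N p (z n) (z (n + 1)))
    (h : Precedes L (y 0) (z 0)) (n : ℕ) : Precedes L (y n) (z n) := by
  induction n with
  | zero => exact h
  | succ n ih =>
    exact S.step_mono (S.iteration_mem hy0 hy n) (S.iteration_mem hz0 hz n) ih (hy n) (hz n)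

theorem iteration_contr (S : Admissible L a b c M N p α β) {y z : ℕ → ℝ → ℝ} {δ : ℝ} (hδ : 0 ≤ δ)
    (hy0 : y 0 ∈ orderInterval L α β) (hz0 : z 0 ∈ orderInterval L α β)
    (hy : ∀ n, IsStep L a b c M N p (y n) (y (n + 1)))
    (hz : ∀ n, IsStep L a b c M N p (z n) (z (n + 1)))
    (h : Precedes L (y 0) (z 0)) (hd : ∀ x ∈ Icc 0 L, D L 2 (y 0) x - D L 2 (z 0) x ≤ δ) (n : ℕ) :
    ∀ x ∈ Icc 0 L, D L 2 (y n) x - D L 2 (z n) x ≤ δ * (1 / 2) ^ n := by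
  induction n with
  | zero => simpa using hd
  | succ n ih =>
    have := S.step_contr (by positivity) (S.iteration_mem hy0 hy n) (S.iteration_mem hz0 hz n)
      (S.iteration_mono hy0 hz0 hy hz h n) (hy n) (hz n) ih
    intro x hx
    refine (this x hx).trans_eq ?_
    ring

/-- The shifted sequence is again an iteration, so the single comparison `α ≼ A 1` propagates to all
`n`. -/
theorem lower_iteration_mono (S : Admissible L a b c M N p α β) {A : ℕ → ℝ → ℝ}
    (hA : IsIteration L a b c M N p α A) (n : ℕ) : Precedes L (A n) (A (n + 1)) := by
  have h0 : A 0 ∈ orderInterval L α β := hA.1 ▸ S.left_mem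
  have h1 : IsStep L a b c M N p α (A 1) := hA.1 ▸ hA.2 0
  exact S.iteration_mono (z := fun n => A (n + 1)) h0 (S.iteration_mem h0 hA.2 1) hA.2
    (fun n => hA.2 (n + 1)) (by rw [hA.1]; exact S.precedes_step h1) n

theorem upper_iteration_mono (S : Admissible L a b c M N p α β) {B : ℕ → ℝ → ℝ}
    (hB : IsIteration L a b c M N p β B) (n : ℕ) : Precedes L (B (n + 1)) (B n) := by
  have h0 : B 0 ∈ orderInterval L α β := hB.1 ▸ S.right_mem
  have h1 : IsStep L a b c M N p β (B 1) := hB.1 ▸ hB.2 0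
  exact S.iteration_mono (y := fun n => B (n + 1)) (S.iteration_mem h0 hB.2 1) h0
    (fun n => hB.2 (n + 1)) hB.2 (by rw [hB.1]; exact S.step_precedes h1) n

theorem lower_precedes_iteration (S : Admissible L a b c M N p α β) {A y : ℕ → ℝ → ℝ}
    (hA : IsIteration L a b c M N p α A) (hy0 : y 0 ∈ orderInterval L α β)
    (hy : ∀ n, IsStep L a b c M N p (y n) (y (n + 1))) (n : ℕ) : Precedes L (A n) (y n) :=
  S.iteration_mono (hA.1 ▸ S.left_mem) hy0 hA.2 hy
    (by rw [hA.1]; exact (mem_orderInterval_iff.1 hy0).2.1) n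

theorem iteration_precedes_upper (S : Admissible L a b c M N p α β) {B y : ℕ → ℝ → ℝ}
    (hB : IsIteration L a b c M N p β B) (hy0 : y 0 ∈ orderInterval L α β)
    (hy : ∀ n, IsStep L a b c M N p (y n) (y (n + 1))) (n : ℕ) : Precedes L (y n) (B n) :=
  S.iteration_mono hy0 (hB.1 ▸ S.right_mem) hy hB.2
    (by rw [hB.1]; exact (mem_orderInterval_iff.1 hy0).2.2) n

/-- The gap between the extremal iterations decays geometrically. -/
theorem exists_gap_bound (S : Admissible L a b c M N p α β) :
    ∃ δ : ℝ, 0 ≤ δ ∧ ∀ A B : ℕ → ℝ → ℝ, IsIteration L a b c M N p α A →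
      IsIteration L a b c M N p β B → ∀ n, ∀ x ∈ Icc 0 L,
        D L 2 (A n) x - D L 2 (B n) x ≤ δ * (1 / 2) ^ n ∧
        B n x - A n x ≤ δ * (1 / 2) ^ n * (L ^ 2 / 8) := by
  have cα := continuousOn_D_two S.hL S.lower.1.contDiffOn
  have cβ := continuousOn_D_two S.hL S.upper.1.contDiffOn
  obtain ⟨δ, hδ⟩ := isCompact_Icc.exists_bound_of_continuousOn (cα.sub cβ)
  have hδ0 : 0 ≤ δ := (norm_nonneg _).trans (hδ 0 (left_mem_Icc.2 S.hL.le))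
  refine ⟨δ, hδ0, fun A B hA hB n => ?_⟩
  have mA : A 0 ∈ orderInterval L α β := hA.1 ▸ S.left_mem
  have mB : B 0 ∈ orderInterval L α β := hB.1 ▸ S.right_mem
  have h2 := S.iteration_contr hδ0 mA mB hA.2 hB.2 (by rw [hA.1, hB.1]; exact S.order)
    (fun x hx => by rw [hA.1, hB.1]; exact (le_abs_self _).trans (hδ x hx)) n
  have iA := S.iteration_mem mA hA.2 n
  have iB := S.iteration_mem mB hB.2 n
  have h0 := sub_le_of_D_two_sub_le S.hL (by positivity) (mem_orderInterval_iff.1 iA).1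
    (mem_orderInterval_iff.1 iB).1
    (by rw [(S.eq_zero_of_mem iA).1, (S.eq_zero_of_mem iB).1])
    (by rw [(S.eq_zero_of_mem iA).2, (S.eq_zero_of_mem iB).2]) h2
  exact fun x hx => ⟨h2 x hx, h0 x hx⟩

/-- Any two iterations started in `[α, β]` approach each other geometrically fast. -/
theorem exists_dist_bound (S : Admissible L a b c M N p α β) :
    ∃ C : ℝ, ∀ y z : ℕ → ℝ → ℝ, y 0 ∈ orderInterval L α β → z 0 ∈ orderInterval L α β →
      (∀ n, IsStep L a b c M N p (y n) (y (n + 1))) →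
      (∀ n, IsStep L a b c M N p (z n) (z (n + 1))) →
      ∀ n, ∀ x ∈ Icc 0 L, dist (z n x) (y n x) ≤ C * (1 / 2) ^ n := by
  obtain ⟨δ, -, h⟩ := S.exists_gap_bound
  obtain ⟨A, hA⟩ := S.exists_iteration S.lower.1.contDiffOn
  obtain ⟨B, hB⟩ := S.exists_iteration S.upper.1.contDiffOn
  -- Both sequences lie between the extremal ones; `y` and `z` need not be comparable with each
  -- other.
  refine ⟨δ * (L ^ 2 / 8), fun y z hy0 hz0 hy hz n x hx => ?_⟩
  have h1 := (h A B hA hB n x hx).2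
  have h2 := (S.lower_precedes_iteration hA hy0 hy n x hx).1
  have h3 := (S.lower_precedes_iteration hA hz0 hz n x hx).1
  have h4 := (S.iteration_precedes_upper hB hy0 hy n x hx).1
  have h5 := (S.iteration_precedes_upper hB hz0 hz n x hx).1
  rw [Real.dist_eq, abs_le]
  constructor <;> linarith

theorem tendsto_geometric_zero (C : ℝ) : Tendsto (fun n : ℕ => C * (1 / 2 : ℝ) ^ n) atTop (𝓝 0) := by
  simpa using (tendsto_pow_atTop_nhds_zero_of_lt_one (by norm_num : (0 : ℝ) ≤ 1 / 2)
    (by norm_num)).const_mul C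

theorem solution_eqOn (S : Admissible L a b c M N p α β) {v w : ℝ → ℝ}
    (hv : IsSolution L a b c p v) (hv' : v ∈ orderInterval L α β)
    (hw : IsSolution L a b c p w) (hw' : w ∈ orderInterval L α β) : EqOn v w (Icc 0 L) := by
  obtain ⟨C, hC⟩ := S.exists_dist_bound
  intro x hx
  refine dist_le_zero.1 (ge_of_tendsto' (tendsto_geometric_zero C) fun n => ?_)
  exact hC (fun _ => w) (fun _ => v) hw' hv' (fun _ => isStep_self_of_isSolution hw)
    (fun _ => isStep_self_of_isSolution hv) n x hx

theorem tendstoUniformlyOn_solution (S : Admissible L a b c M N p α β) {w : ℝ → ℝ}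
    (hw : IsSolution L a b c p w) (hw' : w ∈ orderInterval L α β) {y : ℕ → ℝ → ℝ}
    (hy0 : y 0 ∈ orderInterval L α β) (hy : ∀ n, IsStep L a b c M N p (y n) (y (n + 1))) :
    TendstoUniformlyOn y w atTop (Icc 0 L) := by
  obtain ⟨C, hC⟩ := S.exists_dist_bound
  rw [Metric.tendstoUniformlyOn_iff]
  intro ε hε
  filter_upwards [(tendsto_geometric_zero C).eventually (gt_mem_nhds hε)] with n hn x hx
  exact (hC y (fun _ => w) hy0 hw' hy (fun _ => isStep_self_of_isSolution hw) n x hx).trans_lt hn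

end Admissible

/-! ### Existence of a solution by passage to the limit -/

theorem exists_contDiffOn_D_two_eqOn {L : ℝ} (hL : 0 < L) {ω : ℝ → ℝ}
    (hω : ContinuousOn ω (Icc 0 L)) :
    ∃ w, ContDiffOn ℝ 2 w (Icc 0 L) ∧ EqOn (D L 2 w) ω (Icc 0 L) ∧ w 0 = 0 ∧ w L = 0 := by
  set f : ℝ → ℝ := IccExtend hL.le ((Icc 0 L).domRestrict ω) with hf
  have cf : Continuous f := hω.domRestrict.Icc_extend'
  have ef : EqOn f ω (Icc 0 L) := fun x hx => by rw [hf, IccExtend_of_mem _ _ hx]; rfl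
  set F : ℝ → ℝ := fun x => ∫ s in (0 : ℝ)..x, f s
  have dF : ∀ x, HasDerivAt F (f x) x := fun x => (cf.integral_hasStrictDerivAt 0 x).hasDerivAt
  have cF : Continuous F := continuous_iff_continuousAt.2 fun x => (dF x).continuousAt
  set G : ℝ → ℝ := fun x => ∫ s in (0 : ℝ)..x, F s with hG
  have dG : ∀ x, HasDerivAt G (F x) x := fun x => (cF.integral_hasStrictDerivAt 0 x).hasDerivAt
  obtain ⟨h1, h2⟩ := contDiffOn_of_hasDerivWithinAt₂ (y := fun x => G x - x * (G L / L))
    (y₁ := fun x => F x - 1 * (G L / L)) hL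
    (fun x _ => ((dG x).sub ((hasDerivAt_id x).mul_const _)).hasDerivWithinAt)
    (fun x _ => ((dF x).sub_const _).hasDerivWithinAt) cf.continuousOn
  exact ⟨_, h1, h2.trans ef, by simp [hG], by field_simp; ring⟩

/-- The limit is taken in the second derivatives: `ω` is squeezed between `B n ''` and `A n ''`, the
convergence is uniform, and integrating `ω` twice gives `w` with `A n ≼ w ≼ B n`. No limit in the
differential equation is needed, because the image of `w` under the step is squeezed as well and so
agrees with `w`. -/
theorem Admissible.exists_solution {L a b c M N : ℝ} {p α β : ℝ → ℝ}
    (S : Admissible L a b c M N p α β) :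
    ∃ w, IsSolution L a b c p w ∧ w ∈ orderInterval L α β := by
  have hL := S.hL
  obtain ⟨A, hA⟩ := S.exists_iteration S.lower.1.contDiffOn
  obtain ⟨B, hB⟩ := S.exists_iteration S.upper.1.contDiffOn
  obtain ⟨δ, hδ, gap⟩ := S.exists_gap_bound
  have mA := S.iteration_mem (hA.1 ▸ S.left_mem : A 0 ∈ orderInterval L α β) hA.2
  have mB := S.iteration_mem (hB.1 ▸ S.right_mem : B 0 ∈ orderInterval L α β) hB.2
  have AB := S.lower_precedes_iteration hA (mB 0) hB.2
  have antiA : ∀ x ∈ Icc 0 L, Antitone fun n => D L 2 (A n) x := fun x hx =>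
    antitone_nat_of_succ_le fun n => (S.lower_iteration_mono hA n x hx).2
  have monoB : ∀ x ∈ Icc 0 L, Monotone fun n => D L 2 (B n) x := fun x hx =>
    monotone_nat_of_le_succ fun n => (S.upper_iteration_mono hB n x hx).2
  have BA : ∀ x ∈ Icc 0 L, ∀ m n, D L 2 (B m) x ≤ D L 2 (A n) x := fun x hx m n =>
    ((monoB x hx (le_max_left m n)).trans (AB (max m n) x hx).2).trans
      (antiA x hx (le_max_right m n))
  set ω : ℝ → ℝ := fun x => ⨅ n, D L 2 (A n) x with hω
  have ωA : ∀ x ∈ Icc 0 L, ∀ n, ω x ≤ D L 2 (A n) x := fun x hx n =>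
    ciInf_le ⟨D L 2 (B 0) x, by rintro _ ⟨m, rfl⟩; exact BA x hx 0 m⟩ n
  have Bω : ∀ x ∈ Icc 0 L, ∀ n, D L 2 (B n) x ≤ ω x := fun x hx n => le_ciInf (BA x hx n)
  have unif : TendstoUniformlyOn (fun n => D L 2 (A n)) ω atTop (Icc 0 L) := by
    rw [Metric.tendstoUniformlyOn_iff]
    intro ε hε
    filter_upwards [(tendsto_geometric_zero δ).eventually (gt_mem_nhds hε)] with n hn x hx
    rw [dist_comm, Real.dist_eq, abs_of_nonneg (sub_nonneg.2 (ωA x hx n))]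
    have := (gap A B hA hB n x hx).1
    have := Bω x hx n
    linarith
  have cω : ContinuousOn ω (Icc 0 L) := unif.continuousOn (Frequently.of_forall fun n =>
    continuousOn_D_two hL (mem_orderInterval_iff.1 (mA n)).1)
  obtain ⟨w, cw, ew, w0, wL⟩ := exists_contDiffOn_D_two_eqOn hL cω
  have Aw : ∀ n, Precedes L (A n) w := fun n =>
    precedes_of_D_two_le hL (mem_orderInterval_iff.1 (mA n)).1 cw (S.eq_zero_of_mem (mA n)).1
      (S.eq_zero_of_mem (mA n)).2 w0 wL fun x hx => by rw [ew hx]; exact ωA x hx n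
  have wB : ∀ n, Precedes L w (B n) := fun n =>
    precedes_of_D_two_le hL cw (mem_orderInterval_iff.1 (mB n)).1 w0 wL (S.eq_zero_of_mem (mB n)).1
      (S.eq_zero_of_mem (mB n)).2 fun x hx => by rw [ew hx]; exact Bω x hx n
  have mw : w ∈ orderInterval L α β :=
    mem_orderInterval_iff.2 ⟨cw, hA.1 ▸ Aw 0, hB.1 ▸ wB 0⟩
  obtain ⟨z, hz⟩ := S.exists_step cw
  -- The witness is `z` rather than `w`: as the output of a step it lies in `W^{4,1}`, whereas `w`
  -- is only known to be `C²`.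
  refine ⟨z, isSolution_of_isStep_of_eqOn hL hz fun x hx => ?_, S.step_mem mw hz⟩
  refine dist_le_zero.1 (ge_of_tendsto
    (tendsto_geometric_zero (δ * (L ^ 2 / 8)) |>.comp (tendsto_add_atTop_nat 1))
    (Eventually.of_forall fun n => ?_))
  have h1 := (S.step_mono (mA n) mw (Aw n) (hA.2 n) hz x hx).1
  have h2 := (S.step_mono mw (mB n) (wB n) hz (hB.2 n) x hx).1
  have h3 := (Aw (n + 1) x hx).1
  have h4 := (wB (n + 1) x hx).1
  have h5 := (gap A B hA hB (n + 1) x hx).2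
  simp only [Function.comp]
  rw [Real.dist_eq, abs_le]
  constructor <;> linarith

end Melan

theorem theorem4p2 (L a b c M N : ℝ) (p α β : ℝ → ℝ)
    (hL : 0 < L) (ha : 0 < a) (hb : 0 < b) (hc : 0 < c) (hM : 0 < M) (hN : 0 < N)
    (hp : IntervalIntegrable p volume 0 L)
    (hNM : N ≤ 4 * M / L ^ 3 * Melan.sigma (Real.sqrt M * L))
    (hα : Melan.IsLowerSolution L a b c p α)
    (hβ : Melan.IsUpperSolution L a b c p β)
    (hαβ : ∀ x ∈ Icc 0 L, 0 ≤ α x ∧ α x ≤ β x)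
    (hαβ'' : ∀ x ∈ Icc 0 L, Melan.D L 2 α x ≤ 0 ∧ Melan.D L 2 β x ≤ Melan.D L 2 α x)
    (hβM : a + b * (∫ x in (0 : ℝ)..L, β x) ≤ M)
    (hβN : c - b * sInf (Melan.D L 2 β '' Icc 0 L) ≤ N)
    (hcontr : a + b * (∫ x in (0 : ℝ)..L, α x) + L ^ 3 / 4 * c
      > L ^ 3 * N / 4 + M - 4 / L ^ 2) :
    -- the iterative procedure is well defined for every initial function in `[α, β]`
    (∀ y₀ ∈ Melan.orderInterval L α β, ∃ y, Melan.IsIteration L a b c M N p y₀ y ∧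
      ∀ z, Melan.IsIteration L a b c M N p y₀ z → ∀ n, EqOn (z n) (y n) (Icc 0 L)) ∧
    -- the sequences started from `α` and `β` are monotone and ordered, with second derivatives
    (∀ A B : ℕ → ℝ → ℝ, Melan.IsIteration L a b c M N p α A →
      Melan.IsIteration L a b c M N p β B → ∀ n, ∀ x ∈ Icc 0 L,
        (A n x ≤ A (n + 1) x ∧ A n x ≤ B n x ∧ B (n + 1) x ≤ B n x) ∧
        (Melan.D L 2 (A (n + 1)) x ≤ Melan.D L 2 (A n) x ∧
          Melan.D L 2 (B n) x ≤ Melan.D L 2 (A n) x ∧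
          Melan.D L 2 (B n) x ≤ Melan.D L 2 (B (n + 1)) x)) ∧
    -- there is exactly one solution in `[α, β]`, and all iterations converge to it uniformly
    ∃ w, (Melan.IsSolution L a b c p w ∧ w ∈ Melan.orderInterval L α β) ∧
      (∀ v, Melan.IsSolution L a b c p v → v ∈ Melan.orderInterval L α β →
        EqOn v w (Icc 0 L)) ∧
      (∀ A, Melan.IsIteration L a b c M N p α A → TendstoUniformlyOn A w atTop (Icc 0 L)) ∧
      (∀ B, Melan.IsIteration L a b c M N p β B → TendstoUniformlyOn B w atTop (Icc 0 L)) ∧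
      (∀ y₀ ∈ Melan.orderInterval L α β, ∀ y, Melan.IsIteration L a b c M N p y₀ y →
        TendstoUniformlyOn y w atTop (Icc 0 L)) := by
  have order : Melan.Precedes L α β := fun x hx => ⟨(hαβ x hx).2, (hαβ'' x hx).2⟩
  have S : Melan.Admissible L a b c M N p α β :=
    { hL := hL, hb := hb, hM := hM, hN := hN, hNM := hNM, hp := hp, lower := hα, upper := hβ
      order := order
      concave := fun x hx => (hαβ'' x hx).1
      le_M := hβM
      le_N := fun x hx => by
        -- Boundedness below of `β''` is what makes `sInf` a genuine lower bound.
        have hbdd := (isCompact_Icc.image_of_continuousOn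
          (Melan.continuousOn_D_two hL hβ.1.contDiffOn)).bddBelow
        have := mul_le_mul_of_nonneg_left (csInf_le hbdd (mem_image_of_mem _ hx)) hb.le
        linarith
      contr := by linarith }
  obtain ⟨w, hw, hw'⟩ := S.exists_solution
  refine ⟨fun y₀ hy₀ => ?_, fun A B hA hB n x hx => ?_, w, ⟨hw, hw'⟩,
    fun v hv hv' => S.solution_eqOn hv hv' hw hw',
    fun A hA => S.tendstoUniformlyOn_solution hw hw' (hA.1 ▸ S.left_mem) hA.2,
    fun B hB => S.tendstoUniformlyOn_solution hw hw' (hB.1 ▸ S.right_mem) hB.2,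
    fun y₀ hy₀ y hy => S.tendstoUniformlyOn_solution hw hw' (hy.1 ▸ hy₀) hy.2⟩
  · obtain ⟨y, hy⟩ := S.exists_iteration (Melan.mem_orderInterval_iff.1 hy₀).1
    exact ⟨y, hy, fun z hz n => S.iteration_eqOn hy hz n⟩
  · have h1 := S.lower_iteration_mono hA n x hx
    have h2 := S.upper_iteration_mono hB n x hx
    have h3 := S.lower_precedes_iteration hA (hB.1 ▸ S.right_mem) hB.2 n x hx
    exact ⟨⟨h1.1, h3.1, h2.1⟩, h1.2, h3.2, h2.2⟩
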